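/- Let $\rho\in\mathbb{N}=\{1,2,\dots\}$, $a\in[0,\rho)$, and let $\phi:\mathbb{R}\to\mathbb{C}$ be $\rho-1$ times continuously differentiable with compact support. For $t\in[0,1]$ let $\Psi_\kappa(t)$, $\kappa=(\phi,a,\rho)$, be the $\rho\times\rho$ matrix with entries $$\Psi_\kappa^{ij}(t)=\sum_{k\in\mathbb{Z}}\phi^{(i)}(a+\rho k-j)\,e^{2\pi \mathrm{i}kt},\qquad 0\le i,j\le\rho-1,$$ and assume that $\det\Psi_\kappa(t)\neq0$ for all $t\in[0,1]$. Put $$\Theta_{i,\kappa}(t)=\sum_{v\in\mathbb{Z}}\sum_{j=0}^{\rho-1}\Big(\int_0^1 e^{-2\pi \mathrm{i}vu}(\Psi_\kappa(u)^{-1})^{ji}\,du\Big)\phi(t-\rho v-j),$$ $$(S_W^\kappa f)(t)=\sum_{l\in\mathbb{Z}}\sum_{i=0}^{\rho-1}\frac1{W^i}f^{(i)}\Big(\frac{a+\rho l}{W}\Big)\Theta_{i,\kappa}(Wt-\rho l),\qquad W\ge1 .$$ Let $1\le p<\infty$. A sequence $\Sigma=(x_j)_{j\in\mathbb{Z}}$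 of reals is admissible if $0<\inf_j(x_j-x_{j-1})\le\sup_j(x_j-x_{j-1})<\infty$. Let $\Lambda_\rho^p$ be the set of all bounded Lebesgue measurable $f:\mathbb{R}\to\mathbb{C}$ that are $\rho-1$ times differentiable at every point and satisfy $\sum_{j\in\mathbb{Z}}\sum_{i=0}^{\rho-1}|f^{(i)}(x_j)|^p(x_j-x_{j-1})<\infty$ for every admissible sequence $(x_j)$. For $r\in\mathbb{N}$ and $\delta\ge0$ let $$(\Delta_h^rg)(t)=\sum_{j=0}^r(-1)^{r-j}\binom rj g(t+jh),$$ $$\omega_r(g;x;\delta)=\sup\Big\{|(\Delta_h^rg)(t)|:\ t,\,t+rh\in\big[x-\tfrac{r\delta}2,x+\tfrac{r\delta}2\big]\Big\},$$ $$\tau_r(g;\delta)_p=\|\omega_r(g;\cdot\,;\delta)\|_{L^p(\mathbb{R})}\in[0,\infty].$$ Let $\alpha>0$ and $r\in\mathbb{N}$. Assume that $S_W^\kappa$ reproduces polynomials of order $r$, that is, $S_W^\kappa P=P$ on $\mathbb{R}$ for every polynomial $P$ of degree at most $r$ and every $W\ge1$. If $f\in\Lambda_\rho^p$ and $\tau_r(f^{(i)};\delta)_p=\mathcal{O}(\delta^\alpha)$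 as $\delta\to0+$ for each $i=0,1,\dots,\rho-1$, then for every $W\ge1$ the series defining $S_W^\kappa f$ converges absolutely at every point and $S_W^\kappa f-f\in L^p(\mathbb{R})$, and $$\|S_W^\kappa f-f\|_{L^p(\mathbb{R})}=\mathcal{O}(W^{-\alpha})\qquad(W\to\infty).$$ -/

import Mathlib

open Filter Topology MeasureTheory
open scoped ENNReal NNReal Polynomial

noncomputable section

namespace DerivativeSampling

/-- The `ρ × ρ` symbol `Ψ_κ(t)` of `κ = (φ, a, ρ)`, with entries
`Ψ_κ^{ij}(t) = ∑_{k ∈ ℤ} φ^{(i)}(a + ρ k - j) e^{2 π i k t}`. -/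
def symbol (φ : ℝ → ℂ) (a : ℝ) (ρ : ℕ) (t : ℝ) : Matrix (Fin ρ) (Fin ρ) ℂ :=
  Matrix.of fun i j => ∑' k : ℤ,
    iteratedDeriv (i : ℕ) φ (a + (ρ : ℝ) * (k : ℝ) - ((j : ℕ) : ℝ)) *
      Complex.exp (2 * (Real.pi : ℂ) * Complex.I * (k : ℂ) * (t : ℂ))

/-- The `v`-th Fourier coefficient on `[0, 1]` of the `(j, i)` entry of `Ψ_κ⁻¹`. -/
def invSymbolCoeff (φ : ℝ → ℂ) (a : ℝ) (ρ : ℕ) (j i : Fin ρ) (v : ℤ) : ℂ :=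
  ∫ t in (0 : ℝ)..1,
    Complex.exp (-(2 * (Real.pi : ℂ) * Complex.I * (v : ℂ) * (t : ℂ))) *
      (symbol φ a ρ t)⁻¹ j i

/-- The reconstruction function
`Θ_{i,κ}(t) = ∑_{v ∈ ℤ} ∑_{j < ρ} ((Ψ_κ⁻¹)^{ji})^(v) φ(t - ρ v - j)`. -/
def reconstruction (φ : ℝ → ℂ) (a : ℝ) (ρ : ℕ) (i : Fin ρ) (t : ℝ) : ℂ :=
  ∑' v : ℤ, ∑ j : Fin ρ,
    invSymbolCoeff φ a ρ j i v * φ (t - (ρ : ℝ) * (v : ℝ) - ((j : ℕ) : ℝ))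

/-- The `l`-th term of the sampling series of `f` at `t`. -/
def samplingTerm (φ : ℝ → ℂ) (a : ℝ) (ρ : ℕ) (W : ℝ) (f : ℝ → ℂ) (t : ℝ) (l : ℤ) : ℂ :=
  ∑ i : Fin ρ, (1 / (W : ℂ) ^ (i : ℕ)) *
    iteratedDeriv (i : ℕ) f ((a + (ρ : ℝ) * (l : ℝ)) / W) *
      reconstruction φ a ρ i (W * t - (ρ : ℝ) * (l : ℝ))

/-- The derivative sampling operator `S_W^κ`. -/
def samplingOp (φ : ℝ → ℂ) (a : ℝ) (ρ : ℕ) (W : ℝ) (f : ℝ → ℂ) (t : ℝ) : ℂ :=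
  ∑' l : ℤ, samplingTerm φ a ρ W f t l

/-- Reproducing polynomial property of order `r`: `S_W^κ P = P` on `ℝ` for all polynomials
of degree at most `r` (and all `W ≥ 1`). -/
def ReproducesPolynomials (φ : ℝ → ℂ) (a : ℝ) (ρ r : ℕ) : Prop :=
  ∀ W : ℝ, 1 ≤ W → ∀ P : ℂ[X], P.natDegree ≤ r → ∀ t : ℝ,
    samplingOp φ a ρ W (fun s : ℝ => P.eval (s : ℂ)) t = P.eval (t : ℂ)

/-- The forward difference `(Δ_h^r f)(t)`. -/
def forwardDiff (r : ℕ) (h : ℝ) (f : ℝ → ℂ) (t : ℝ) : ℂ :=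
  ∑ j ∈ Finset.range (r + 1), (-1 : ℂ) ^ (r - j) * (r.choose j : ℂ) * f (t + (j : ℝ) * h)

/-- The local modulus of smoothness `ω_r(f; x; δ)`, with values in `[0, ∞]`. -/
def localModulus (r : ℕ) (f : ℝ → ℂ) (x δ : ℝ) : ℝ≥0∞ :=
  ⨆ (t : ℝ) (h : ℝ)
    (_ : t ∈ Set.Icc (x - r * δ / 2) (x + r * δ / 2) ∧
      t + r * h ∈ Set.Icc (x - r * δ / 2) (x + r * δ / 2)),
    ‖forwardDiff r h f t‖ₑ

/-- The `L^p`-averaged modulus of smoothness `τ_r(f; δ)_p`, with values in `[0, ∞]`. -/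
def tauModulus (r : ℕ) (p : ℝ) (f : ℝ → ℂ) (δ : ℝ) : ℝ≥0∞ :=
  (∫⁻ x : ℝ, localModulus r f x δ ^ p) ^ (1 / p)

/-- Admissible sequences: the gaps `x_j - x_{j-1}` are bounded above, and below by a positive
number. -/
def Admissible (x : ℤ → ℝ) : Prop :=
  ∃ d D : ℝ, 0 < d ∧ ∀ j : ℤ, d ≤ x j - x (j - 1) ∧ x j - x (j - 1) ≤ D

/-- The discrete norm `‖f‖_{ℓ_ρ^p(Σ)}`, with values in `[0, ∞]`. -/
def discreteNorm (ρ : ℕ) (p : ℝ) (x : ℤ → ℝ) (f : ℝ → ℂ) : ℝ≥0∞ :=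
  (∑' j : ℤ, ∑ i ∈ Finset.range ρ,
    ‖iteratedDeriv i f (x j)‖ₑ ^ p * ENNReal.ofReal (x j - x (j - 1))) ^ (1 / p)

/-- The space `Λ_ρ^p`: bounded (Lebesgue) measurable functions with finite discrete norm for each
admissible sequence. As every real number belongs to an admissible sequence, this
includes that `f` is `ρ - 1` times differentiable at every point. -/
structure MemLambda (ρ : ℕ) (p : ℝ) (f : ℝ → ℂ) : Prop where
  measurable : AEMeasurable f volume
  bounded : ∃ C : ℝ, ∀ t : ℝ, ‖f t‖ ≤ C
  differentiable : ∀ i : ℕ, i + 1 < ρ → Differentiable ℝ (iteratedDeriv i f)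
  norm_lt_top : ∀ x : ℤ → ℝ, Admissible x → discreteNorm ρ p x f < ∞

end DerivativeSampling

end

noncomputable section

namespace DerivativeSampling

/-! ### Weights on the integers -/

/-! Since `φ` has compact support, the symbol is a matrix of trigonometric polynomials. Its
determinant does not vanish, so its inverse is smooth and periodic, with Fourier coefficients
decaying faster than any power; so do the functions Θ_i (`exists_reconstruction_decay`). Hence S_W
is essentially local at scale 1/W.

Take a mesh d comparable to 1/W and fix t. Reproduction of polynomials gives S_W f(t) - f(t) = S_W(f
- P)(t) - (f - P)(t) for any admissible P, which may depend on t. What is needed is a P that is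
close to f, together with derivatives, at the sampling points, with an error expressed by
differences of order r only, because f need not have r derivatives. Averaging Δ_h^r f(x) over h
produces a smooth G for which f - G and d^r G^(r) are both controlled by such differences
(`exists_smoothing`); P is the Taylor polynomial of G at t (`exists_local_polynomial`). The
derivatives of u = f - P are then bounded by an inequality of Landau type: bounds for u and for
Δ_h^r u' give one for u', and Δ_h^r annihilates the derivatives of P
(`norm_iterated_le_of_forwardDiff`). The outcome is `exists_simultaneous_approximation`.

The approximation error grows polynomially with the number of cells between t and the sample, which
the decay of Θ_i absorbs. The error on a cell is thus dominated by the convolution of the moduli on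
cells with a summable weight (`exists_pointwise_error_bound`). A discrete Young inequality passes to
ℓ^p, and the modulus on a cell is at most the local modulus of step 2Ld at every point of the cell,
so the ℓ^p sums are bounded by τ_r(f^(i); 2Ld)_p (`exists_eLpNorm_error_bound`). -/

theorem summable_inv_one_add_abs_sq :
    Summable fun v : ℤ => ((1 + |(v : ℝ)|) ^ 2)⁻¹ := by
  have h1 : Summable fun n : ℕ => ((1 + (n : ℝ)) ^ 2)⁻¹ := by
    have h := (summable_nat_add_iff 1).2 (Real.summable_nat_pow_inv.2 (one_lt_two))
    refine h.congr fun n => ?_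
    push_cast
    rw [add_comm]
  refine Summable.of_nat_of_neg ?_ ?_
  · simpa using h1
  · simpa using h1

/-- Shifting `l` by ⌊x/ρ⌋ compares the sum with the one at the origin, at the cost of a factor 2² =
4; this makes the constant uniform in `x`. -/
theorem exists_tsum_inv_one_add_abs_le (ρ : ℕ) (hρ : 1 ≤ ρ) :
    ∃ C : ℝ, 0 ≤ C ∧ ∀ x : ℝ,
      (Summable fun l : ℤ => ((1 + |x - ρ * (l : ℝ)|) ^ 2)⁻¹) ∧
        ∑' l : ℤ, ((1 + |x - ρ * (l : ℝ)|) ^ 2)⁻¹ ≤ C := by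
  refine ⟨∑' v : ℤ, 4 * ((1 + |(v : ℝ)|) ^ 2)⁻¹, tsum_nonneg fun v => by positivity, fun x => ?_⟩
  have hρ' : (1 : ℝ) ≤ ρ := by exact_mod_cast hρ
  have hs := summable_inv_one_add_abs_sq.mul_left 4
  have hs' := (Equiv.subRight ⌊x / ρ⌋).summable_iff.2 hs
  have hle : ∀ l : ℤ, ((1 + |x - ρ * (l : ℝ)|) ^ 2)⁻¹ ≤
      4 * ((1 + |((l - ⌊x / ρ⌋ : ℤ) : ℝ)|) ^ 2)⁻¹ := by
    intro l
    have h1 : |(l : ℝ) - x / ρ| ≤ |x - ρ * l| := by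
      have : x - ρ * l = -(ρ * (l - x / ρ)) := by field_simp; ring
      rw [this, abs_neg, abs_mul, abs_of_nonneg (by linarith : (0 : ℝ) ≤ ρ)]
      nlinarith [abs_nonneg ((l : ℝ) - x / ρ)]
    have h2 : |((l - ⌊x / ρ⌋ : ℤ) : ℝ)| ≤ |(l : ℝ) - x / ρ| + 1 := by
      have e : ((l - ⌊x / ρ⌋ : ℤ) : ℝ) = ((l : ℝ) - x / ρ) + (x / ρ - ⌊x / ρ⌋) := by
        push_cast; ring
      rw [e]
      refine (abs_add_le _ _).trans ?_
      have a1 := Int.floor_le (x / ρ)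
      have a2 := Int.lt_floor_add_one (x / ρ)
      have : |x / ρ - ⌊x / ρ⌋| ≤ 1 := by rw [abs_le]; constructor <;> linarith
      linarith
    have h3 : 1 + |((l - ⌊x / ρ⌋ : ℤ) : ℝ)| ≤ 2 * (1 + |x - ρ * (l : ℝ)|) := by
      linarith [abs_nonneg (x - ρ * (l : ℝ))]
    rw [← div_eq_mul_inv, le_div_iff₀ (by positivity), inv_mul_le_iff₀ (by positivity)]
    calc _ ≤ (2 * (1 + |x - ρ * (l : ℝ)|)) ^ 2 := by gcongr
      _ = _ := by ring
  have hsum : Summable fun l : ℤ => ((1 + |x - ρ * (l : ℝ)|) ^ 2)⁻¹ :=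
    Summable.of_nonneg_of_le (fun l => by positivity) hle hs'
  refine ⟨hsum, (hsum.tsum_le_tsum hle hs').trans ?_⟩
  exact ((Equiv.subRight ⌊x / ρ⌋).tsum_eq
    (fun v : ℤ => 4 * ((1 + |(v : ℝ)|) ^ 2)⁻¹)).le

/-! ### Decay of the Fourier coefficients of the inverse symbol -/

theorem fourierCoeff_deriv_of_periodic {g : ℝ → ℂ} (hg : ContDiff ℝ 1 g)
    (hper : Function.Periodic g 1) (v : ℤ) :
    ∫ t in (0 : ℝ)..1,
        Complex.exp (-(2 * (Real.pi : ℂ) * Complex.I * (v : ℂ) * (t : ℂ))) * deriv g t =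
      2 * (Real.pi : ℂ) * Complex.I * (v : ℂ) * ∫ t in (0 : ℝ)..1,
        Complex.exp (-(2 * (Real.pi : ℂ) * Complex.I * (v : ℂ) * (t : ℂ))) * g t := by
  have he : ∀ t : ℝ, HasDerivAt
      (fun t : ℝ => Complex.exp (-(2 * (Real.pi : ℂ) * Complex.I * (v : ℂ) * (t : ℂ))))
      (Complex.exp (-(2 * (Real.pi : ℂ) * Complex.I * (v : ℂ) * (t : ℂ))) *
        (-(2 * (Real.pi : ℂ) * Complex.I * (v : ℂ)))) t := by
    intro t
    have h1 : HasDerivAt (fun t : ℝ => (t : ℂ)) 1 t := Complex.ofRealCLM.hasDerivAt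
    have h2 := ((h1.const_mul (2 * (Real.pi : ℂ) * Complex.I * (v : ℂ))).neg).cexp
    simpa using h2
  have hgd : ∀ t : ℝ, HasDerivAt g (deriv g t) t := fun t =>
    (hg.differentiable (by norm_num) t).hasDerivAt
  have hg' : Continuous (deriv g) := hg.continuous_deriv (by norm_num)
  have key := intervalIntegral.integral_mul_deriv_eq_deriv_mul (a := 0) (b := 1)
    (fun t _ => he t) (fun t _ => hgd t)
    (Continuous.intervalIntegrable (by fun_prop) _ _) (hg'.intervalIntegrable _ _)
  rw [key]
  have g01 : g 1 = g 0 := by simpa using hper 0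
  have e1 : Complex.exp (-(2 * (Real.pi : ℂ) * Complex.I * (v : ℂ) * ((1 : ℝ) : ℂ))) = 1 := by
    rw [Complex.exp_eq_one_iff]
    exact ⟨-v, by push_cast; ring⟩
  rw [e1, g01]
  rw [← intervalIntegral.integral_const_mul]
  simp only [Complex.ofReal_zero, mul_zero, neg_zero, Complex.exp_zero, sub_self, zero_sub]
  rw [← intervalIntegral.integral_neg]
  congr 1
  ext t
  ring

/-- Integration by parts has no boundary terms for periodic `g`, so each derivative gains one power
of `v`. The induction writes (1+|v|)^(N+1) as (1+|v|)^N plus (1+|v|)^N |v| and applies the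
hypothesis to `g` and to its derivative. -/
theorem exists_fourierCoeff_decay (N : ℕ) : ∀ {g : ℝ → ℂ}, ContDiff ℝ (⊤ : ℕ∞) g →
    Function.Periodic g 1 → ∃ C : ℝ, 0 ≤ C ∧ ∀ v : ℤ,
      (1 + |(v : ℝ)|) ^ N * ‖∫ t in (0 : ℝ)..1,
        Complex.exp (-(2 * (Real.pi : ℂ) * Complex.I * (v : ℂ) * (t : ℂ))) * g t‖ ≤ C := by
  induction N with
  | zero =>
    intro g hg _
    obtain ⟨C, hC⟩ := (isCompact_Icc (a := (0 : ℝ)) (b := 1)).exists_bound_of_continuousOn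
      hg.continuous.continuousOn
    refine ⟨C, (norm_nonneg _).trans (hC 0 (by simp)), fun v => ?_⟩
    rw [pow_zero, one_mul]
    refine (intervalIntegral.norm_integral_le_of_norm_le_const (C := C) fun t ht => ?_).trans
      (by simp)
    rw [Set.uIoc_of_le zero_le_one] at ht
    have : ‖Complex.exp (-(2 * (Real.pi : ℂ) * Complex.I * (v : ℂ) * (t : ℂ)))‖ = 1 := by
      rw [Complex.norm_exp]
      simp
    rw [norm_mul, this, one_mul]
    exact hC t ⟨ht.1.le, ht.2⟩
  | succ N ih =>
    intro g hg hper
    have hg1 : ContDiff ℝ 1 g := hg.of_le (by exact_mod_cast le_top)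
    have hdper : Function.Periodic (deriv g) 1 := by
      intro t
      have : (fun s => g (s + 1)) = g := funext hper
      rw [← deriv_comp_add_const, this]
    obtain ⟨C₁, h₁, hC₁⟩ := ih hg hper
    obtain ⟨C₂, h₂, hC₂⟩ := ih (contDiff_infty_iff_deriv.1 hg).2 hdper
    refine ⟨C₁ + C₂, by positivity, fun v => ?_⟩
    have e := congrArg norm (fourierCoeff_deriv_of_periodic hg1 hper v)
    specialize hC₁ v
    specialize hC₂ v
    set I := ‖∫ t in (0 : ℝ)..1,
        Complex.exp (-(2 * (Real.pi : ℂ) * Complex.I * (v : ℂ) * (t : ℂ))) * g t‖ with hI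
    rw [e, norm_mul, ← hI] at hC₂
    have hI0 : 0 ≤ I := norm_nonneg _
    have hn : ‖2 * (Real.pi : ℂ) * Complex.I * (v : ℂ)‖ = 2 * Real.pi * |(v : ℝ)| := by
      simp [abs_of_nonneg Real.pi_pos.le]
    rw [hn] at hC₂
    have hπ : |(v : ℝ)| * I ≤ 2 * Real.pi * |(v : ℝ)| * I := by
      gcongr
      nlinarith [Real.pi_gt_three, abs_nonneg (v : ℝ)]
    have hw : 0 ≤ (1 + |(v : ℝ)|) ^ N := by positivity
    have e2 : (1 + |(v : ℝ)|) ^ (N + 1) * I =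
        (1 + |(v : ℝ)|) ^ N * I + (1 + |(v : ℝ)|) ^ N * (|(v : ℝ)| * I) := by ring
    rw [e2]
    exact add_le_add hC₁ ((mul_le_mul_of_nonneg_left hπ hw).trans hC₂)

theorem iteratedDeriv_eq_zero_of_hasCompactSupport {φ : ℝ → ℂ} (hφ : HasCompactSupport φ) :
    ∃ R : ℝ, 0 ≤ R ∧ ∀ (i : ℕ) (x : ℝ), R < |x| → iteratedDeriv i φ x = 0 := by
  obtain ⟨R, hR⟩ := hφ.isCompact.isBounded.exists_norm_le
  refine ⟨max R 0, le_max_right _ _, fun i x hx => ?_⟩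
  have hx' : x ∉ tsupport φ := fun h => by
    have := hR x h
    rw [Real.norm_eq_abs] at this
    exact absurd hx (not_lt.2 (this.trans (le_max_left _ _)))
  have h0 : x ∉ Function.support (iteratedFDeriv ℝ i φ) := fun h =>
    hx' (support_iteratedFDeriv_subset (𝕜 := ℝ) i h)
  rw [Function.notMem_support] at h0
  rw [iteratedDeriv, h0]
  rfl

theorem exists_symbol_eq_sum {φ : ℝ → ℂ} (hφ : HasCompactSupport φ) (a : ℝ) {ρ : ℕ}
    (hρ : 1 ≤ ρ) (i j : Fin ρ) : ∃ s : Finset ℤ, ∀ t : ℝ, symbol φ a ρ t i j = ∑ k ∈ s,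
      iteratedDeriv (i : ℕ) φ (a + (ρ : ℝ) * (k : ℝ) - ((j : ℕ) : ℝ)) *
      Complex.exp (2 * (Real.pi : ℂ) * Complex.I * (k : ℂ) * (t : ℂ)) := by
  obtain ⟨R, hR0, hR⟩ := iteratedDeriv_eq_zero_of_hasCompactSupport hφ
  -- As ρ ≥ 1, |k| is at most |ρk|, hence at most |a + ρk - j| + |a| + ρ; so |k| > M puts the
  -- argument outside the support, whatever `t` is.
  obtain ⟨M, hM⟩ := exists_nat_gt (R + |a| + ρ)
  refine ⟨Finset.Icc (-(M : ℤ)) M, fun t => ?_⟩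
  rw [symbol, Matrix.of_apply]
  refine tsum_eq_sum fun k hk => ?_
  rw [hR, zero_mul]
  have hk' : (M : ℝ) < |(k : ℝ)| := by
    by_contra h
    rw [not_lt, abs_le] at h
    exact hk (Finset.mem_Icc.2 ⟨by exact_mod_cast h.1, by exact_mod_cast h.2⟩)
  have hρ' : (1 : ℝ) ≤ ρ := by exact_mod_cast hρ
  have hj : ((j : ℕ) : ℝ) ≤ ρ := by exact_mod_cast j.2.le
  have h1 : |(k : ℝ)| ≤ |(ρ : ℝ) * k| := by
    rw [abs_mul, abs_of_nonneg (by linarith : (0 : ℝ) ≤ ρ)]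
    nlinarith [abs_nonneg (k : ℝ)]
  have h2 : |(ρ : ℝ) * k| ≤ |a + (ρ : ℝ) * (k : ℝ) - ((j : ℕ) : ℝ)| + |a| + j := by
    have e : (ρ : ℝ) * k = (a + (ρ : ℝ) * (k : ℝ) - ((j : ℕ) : ℝ)) - a + j := by ring
    have := abs_add_le ((a + (ρ : ℝ) * (k : ℝ) - ((j : ℕ) : ℝ)) - a) (j : ℝ)
    have h3 := abs_sub (a + (ρ : ℝ) * (k : ℝ) - ((j : ℕ) : ℝ)) a
    rw [← e, abs_of_nonneg (Nat.cast_nonneg (j : ℕ) : (0 : ℝ) ≤ ((j : ℕ) : ℝ))] at this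
    linarith
  linarith

theorem contDiff_matrix_det {n : ℕ} {A : ℝ → Matrix (Fin n) (Fin n) ℂ}
    (hA : ∀ i j, ContDiff ℝ (⊤ : ℕ∞) fun t => A t i j) : ContDiff ℝ (⊤ : ℕ∞) fun t => (A t).det := by
  simp only [Matrix.det_apply]
  refine ContDiff.sum fun σ _ => ?_
  exact (contDiff_prod fun i _ => hA _ _).const_smul _

theorem contDiff_matrix_inv {n : ℕ} {A : ℝ → Matrix (Fin n) (Fin n) ℂ}
    (hA : ∀ i j, ContDiff ℝ (⊤ : ℕ∞) fun t => A t i j) (hdet : ∀ t, (A t).det ≠ 0) (i j : Fin n) :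
    ContDiff ℝ (⊤ : ℕ∞) fun t => (A t)⁻¹ i j := by
  simp only [Matrix.inv_def, Ring.inverse_eq_inv', Matrix.smul_apply, smul_eq_mul,
    Matrix.adjugate_apply]
  refine ((contDiff_matrix_det hA).inv hdet).mul (contDiff_matrix_det fun k l => ?_)
  by_cases h : k = j
  · subst h
    simp only [Matrix.updateRow_self]
    exact contDiff_const
  · simp only [Matrix.updateRow_ne h]
    exact hA k l

theorem exists_invSymbolCoeff_decay {φ : ℝ → ℂ} (hφ : HasCompactSupport φ) (a : ℝ) {ρ : ℕ}
    (hρ : 1 ≤ ρ) (hΨ : ∀ t ∈ Set.Icc (0 : ℝ) 1, (symbol φ a ρ t).det ≠ 0) (N : ℕ)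
    (j i : Fin ρ) : ∃ C : ℝ, 0 ≤ C ∧ ∀ v : ℤ,
      (1 + |(v : ℝ)|) ^ N * ‖invSymbolCoeff φ a ρ j i v‖ ≤ C := by
  have hper : Function.Periodic (symbol φ a ρ) 1 := by
    intro t
    ext k l
    obtain ⟨s, hs⟩ := exists_symbol_eq_sum hφ a hρ k l
    rw [hs, hs]
    refine Finset.sum_congr rfl fun n _ => ?_
    congr 1
    rw [Complex.exp_eq_exp_iff_exists_int]
    exact ⟨n, by push_cast; ring⟩
  -- Periodicity extends the hypothesis from [0,1] to the line, so that the inverse is smooth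
  -- everywhere.
  have hdet : ∀ t, (symbol φ a ρ t).det ≠ 0 := by
    intro t
    have h1 : symbol φ a ρ (Int.fract t) = symbol φ a ρ t := by
      have := hper.sub_int_mul_eq (x := t) ⌊t⌋
      rwa [mul_one] at this
    rw [← h1]
    exact hΨ _ ⟨Int.fract_nonneg t, (Int.fract_lt_one t).le⟩
  have hsm : ∀ k l, ContDiff ℝ (⊤ : ℕ∞) fun t => symbol φ a ρ t k l := by
    intro k l
    obtain ⟨s, hs⟩ := exists_symbol_eq_sum hφ a hρ k l
    simp only [hs]
    refine ContDiff.sum fun n _ => contDiff_const.mul (ContDiff.cexp (contDiff_const.mul ?_))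
    exact Complex.ofRealCLM.contDiff
  refine exists_fourierCoeff_decay N (contDiff_matrix_inv hsm hdet j i) ?_
  intro t
  simp only [hper t]

/-! ### The reconstruction functions -/

theorem one_add_abs_le_mul (x y : ℝ) : 1 + |x + y| ≤ (1 + |x|) * (1 + |y|) := by
  nlinarith [abs_add_le x y, abs_nonneg x, abs_nonneg y, mul_nonneg (abs_nonneg x) (abs_nonneg y)]

/-- The weight is submultiplicative: (1+|x|)^N splits into a weight in the argument of `φ`, harmless
by compact support, and N powers of 1+|v|. Decay of order N+2 of the coefficients pays for the
latter and leaves two powers to sum over `v`. -/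
theorem exists_reconstruction_term_bound {φ : ℝ → ℂ} (hφ : Continuous φ)
    (hφc : HasCompactSupport φ) (a : ℝ) {ρ : ℕ}
    (hρ : 1 ≤ ρ) (hΨ : ∀ t ∈ Set.Icc (0 : ℝ) 1, (symbol φ a ρ t).det ≠ 0) (N : ℕ)
    (i : Fin ρ) : ∃ C : ℝ, 0 ≤ C ∧ ∀ (x : ℝ) (v : ℤ),
      (1 + |x|) ^ N * ‖∑ j : Fin ρ,
        invSymbolCoeff φ a ρ j i v * φ (x - (ρ : ℝ) * (v : ℝ) - ((j : ℕ) : ℝ))‖ ≤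
      C * ((1 + |(v : ℝ)|) ^ 2)⁻¹ := by
  choose C hC0 hC using fun j => exists_invSymbolCoeff_decay hφc a hρ hΨ (N + 2) j i
  obtain ⟨B, hB⟩ : ∃ B, ∀ y : ℝ, ‖((1 + |y| : ℝ) : ℂ) ^ N * φ y‖ ≤ B := by
    refine Continuous.bounded_above_of_compact_support (by fun_prop) ?_
    exact hφc.mul_left
  have hρ' : (1 : ℝ) ≤ ρ := by exact_mod_cast hρ
  have hB0 : 0 ≤ B := (norm_nonneg _).trans (hB 0)
  refine ⟨∑ j, (1 + (ρ : ℝ)) ^ (2 * N) * (C j * B), Finset.sum_nonneg fun j _ => by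
    have := hC0 j; positivity, fun x v => ?_⟩
  rw [Finset.sum_mul]
  refine (mul_le_mul_of_nonneg_left (norm_sum_le _ _) (by positivity)).trans ?_
  rw [Finset.mul_sum]
  refine Finset.sum_le_sum fun j _ => ?_
  set y := x - (ρ : ℝ) * (v : ℝ) - ((j : ℕ) : ℝ) with hy
  have hj : ((j : ℕ) : ℝ) ≤ ρ := by exact_mod_cast j.2.le
  have h1 : 1 + |x| ≤ (1 + |y|) * ((1 + (ρ : ℝ)) ^ 2 * (1 + |(v : ℝ)|)) := by
    have e : x = y + ((ρ : ℝ) * v + j) := by rw [hy]; ring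
    have h2 := one_add_abs_le_mul y ((ρ : ℝ) * v + j)
    rw [← e] at h2
    have h3 := one_add_abs_le_mul ((ρ : ℝ) * v) (j : ℝ)
    have h4 : 1 + |(ρ : ℝ) * v| ≤ (1 + ρ) * (1 + |(v : ℝ)|) := by
      rw [abs_mul, abs_of_nonneg (by linarith : (0 : ℝ) ≤ ρ)]
      nlinarith [abs_nonneg (v : ℝ)]
    have h5 : 1 + |((j : ℕ) : ℝ)| ≤ 1 + ρ := by
      rw [abs_of_nonneg (Nat.cast_nonneg _)]; linarith
    have h6 : 1 + |(ρ : ℝ) * v + j| ≤ (1 + (ρ : ℝ)) ^ 2 * (1 + |(v : ℝ)|) := by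
      calc _ ≤ _ := h3
        _ ≤ ((1 + ρ) * (1 + |(v : ℝ)|)) * (1 + ρ) := by gcongr
        _ = _ := by ring
    exact h2.trans (by gcongr)
  have h7 : (1 + |y|) ^ N * ‖φ y‖ ≤ B := by
    have := hB y
    rw [norm_mul, norm_pow, Complex.norm_real, Real.norm_of_nonneg (by positivity)] at this
    exact this
  have h8 := hC j v
  rw [norm_mul, ← div_eq_mul_inv, le_div_iff₀ (by positivity)]
  have h9 : (1 + |x|) ^ N ≤ ((1 + |y|) * ((1 + (ρ : ℝ)) ^ 2 * (1 + |(v : ℝ)|))) ^ N := by gcongr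
  calc (1 + |x|) ^ N * (‖invSymbolCoeff φ a ρ j i v‖ * ‖φ y‖) * (1 + |(v : ℝ)|) ^ 2
      ≤ ((1 + |y|) * ((1 + (ρ : ℝ)) ^ 2 * (1 + |(v : ℝ)|))) ^ N *
        (‖invSymbolCoeff φ a ρ j i v‖ * ‖φ y‖) * (1 + |(v : ℝ)|) ^ 2 := by gcongr
    _ = (1 + (ρ : ℝ)) ^ (2 * N) * (((1 + |(v : ℝ)|) ^ (N + 2) * ‖invSymbolCoeff φ a ρ j i v‖) *
        ((1 + |y|) ^ N * ‖φ y‖)) := by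
      rw [mul_pow, mul_pow, ← pow_mul]; ring
    _ ≤ (1 + (ρ : ℝ)) ^ (2 * N) * (C j * B) := by
      have := hC0 j
      gcongr

theorem exists_reconstruction_decay {φ : ℝ → ℂ} (hφ : Continuous φ)
    (hφc : HasCompactSupport φ) (a : ℝ) {ρ : ℕ}
    (hρ : 1 ≤ ρ) (hΨ : ∀ t ∈ Set.Icc (0 : ℝ) 1, (symbol φ a ρ t).det ≠ 0) (N : ℕ) :
    ∃ C : ℝ, 0 ≤ C ∧ ∀ (i : Fin ρ) (x : ℝ),
      (1 + |x|) ^ N * ‖reconstruction φ a ρ i x‖ ≤ C := by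
  choose C hC0 hC using exists_reconstruction_term_bound hφ hφc a hρ hΨ N
  set S := ∑' v : ℤ, ((1 + |(v : ℝ)|) ^ 2)⁻¹ with hS
  have hS0 : 0 ≤ S := tsum_nonneg fun v => by positivity
  refine ⟨∑ i, C i * S, Finset.sum_nonneg fun i _ => mul_nonneg (hC0 i) hS0, fun i x => ?_⟩
  refine le_trans ?_ (Finset.single_le_sum (f := fun i => C i * S)
    (fun i _ => mul_nonneg (hC0 i) hS0) (Finset.mem_univ i))
  have h1 : ∀ v : ℤ, ‖∑ j : Fin ρ,
        invSymbolCoeff φ a ρ j i v * φ (x - (ρ : ℝ) * (v : ℝ) - ((j : ℕ) : ℝ))‖ ≤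
      ((1 + |x|) ^ N)⁻¹ * (C i * ((1 + |(v : ℝ)|) ^ 2)⁻¹) := fun v => by
    rw [inv_mul_eq_div, le_div_iff₀ (by positivity), mul_comm]
    exact hC i x v
  have h2 := tsum_of_norm_bounded
    ((summable_inv_one_add_abs_sq.mul_left (C i)).mul_left _).hasSum h1
  rw [tsum_mul_left, tsum_mul_left, inv_mul_eq_div, le_div_iff₀ (by positivity), mul_comm] at h2
  exact h2

theorem measurable_tsum_int {f : ℤ → ℝ → ℂ} (hf : ∀ k, Measurable (f k))
    (hs : ∀ x, Summable fun k => f k x) : Measurable fun x => ∑' k, f k x := by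
  refine measurable_of_tendsto_metrizable' (u := atTop)
    (f := fun (s : Finset ℤ) (x : ℝ) => ∑ k ∈ s, f k x)
    (fun s => Finset.measurable_sum _ fun k _ => hf k) ?_
  rw [tendsto_pi_nhds]
  exact fun x => (hs x).hasSum

theorem measurable_reconstruction {φ : ℝ → ℂ} (hφ : Continuous φ)
    (hφc : HasCompactSupport φ) (a : ℝ) {ρ : ℕ}
    (hρ : 1 ≤ ρ) (hΨ : ∀ t ∈ Set.Icc (0 : ℝ) 1, (symbol φ a ρ t).det ≠ 0) (i : Fin ρ) :
    Measurable (reconstruction φ a ρ i) := by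
  obtain ⟨C, hC0, hC⟩ := exists_reconstruction_term_bound hφ hφc a hρ hΨ 0 i
  refine measurable_tsum_int (fun v => ?_) fun x => ?_
  · exact Continuous.measurable (by fun_prop)
  · refine Summable.of_norm_bounded (summable_inv_one_add_abs_sq.mul_left C) fun v => ?_
    simpa using hC x v

/-! ### Averages and difference quotients -/

/-- The average of `g` over the segment from `t` to `t + s`. -/
def avg (s : ℝ) (g : ℝ → ℂ) (t : ℝ) : ℂ := ∫ u in (0 : ℝ)..1, g (t + s * u)

/-- The difference quotient of `g` with step `s`. -/
def diffQuot (s : ℝ) (g : ℝ → ℂ) (t : ℝ) : ℂ := (g (t + s) - g t) / s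

/-- Integrability on all bounded intervals. -/
def LocInt (g : ℝ → ℂ) : Prop := ∀ a b : ℝ, IntervalIntegrable g volume a b

theorem avg_zero (g : ℝ → ℂ) : avg 0 g = g := by
  ext t
  simp [avg]

theorem avg_eq {s : ℝ} (hs : s ≠ 0) {g : ℝ → ℂ} (hg : LocInt g) (t : ℝ) :
    avg s g t = (s : ℂ)⁻¹ * ((∫ x in (0 : ℝ)..(t + s), g x) - ∫ x in (0 : ℝ)..t, g x) := by
  rw [avg, intervalIntegral.integral_comp_add_mul g hs,
    intervalIntegral.integral_interval_sub_left (hg _ _) (hg _ _)]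
  simp

theorem LocInt.comp_affine {g : ℝ → ℂ} (hg : LocInt g) (t s : ℝ) :
    LocInt fun u => g (t + s * u) := by
  intro a b
  rcases eq_or_ne s 0 with rfl | hs
  · simp
  · have h := hg (t + s * a) (t + s * b)
    have h1 := h.comp_add_left t
    have h2 := h1.comp_mul_left (c := s)
    simpa [hs] using h2

theorem continuous_avg {s : ℝ} (hs : s ≠ 0) {g : ℝ → ℂ} (hg : LocInt g) :
    Continuous (avg s g) := by
  have h := intervalIntegral.continuous_primitive hg 0
  rw [funext (avg_eq hs hg)]
  exact continuous_const.mul ((h.comp (continuous_id.add continuous_const)).sub h)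

theorem LocInt.avg {g : ℝ → ℂ} (hg : LocInt g) (s : ℝ) : LocInt (avg s g) := by
  rcases eq_or_ne s 0 with rfl | hs
  · rwa [avg_zero]
  · exact fun a b => (continuous_avg hs hg).intervalIntegrable a b

theorem LocInt.diffQuot {g : ℝ → ℂ} (hg : LocInt g) (s : ℝ) : LocInt (diffQuot s g) := by
  intro a b
  refine IntervalIntegrable.div_const (IntervalIntegrable.sub ?_ (hg a b)) _
  have := hg.comp_affine s 1 a b
  simpa [add_comm] using this

theorem hasDerivAt_avg {s : ℝ} (hs : s ≠ 0) {g : ℝ → ℂ} (hg : Continuous g) (t : ℝ) :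
    HasDerivAt (avg s g) (diffQuot s g t) t := by
  have hi : LocInt g := fun a b => hg.intervalIntegrable a b
  rw [funext (avg_eq hs hi)]
  have h : ∀ x : ℝ, HasDerivAt (fun y => ∫ z in (0 : ℝ)..y, g z) (g x) x := fun x =>
    intervalIntegral.integral_hasDerivAt_right (hi _ _)
      (hg.stronglyMeasurableAtFilter _ _) hg.continuousAt
  have h1 := ((h (t + s)).comp_add_const t s).sub (h t)
  have h2 := h1.const_mul ((s : ℂ)⁻¹)
  rw [diffQuot, div_eq_inv_mul]
  exact h2

theorem avg_diffQuot {g : ℝ → ℂ} (hg : LocInt g) (s : ℝ) :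
    diffQuot s (avg s g) = avg s (diffQuot s g) := by
  ext t
  simp only [diffQuot, avg]
  rw [intervalIntegral.integral_div, intervalIntegral.integral_sub]
  · congr 2
    refine intervalIntegral.integral_congr fun u _ => congrArg g ?_
    ring
  · have := hg.comp_affine (t + s) s 0 1
    refine this.congr ?_
    refine fun u _ => congrArg g ?_
    ring
  · exact hg.comp_affine t s 0 1

theorem LocInt.diffQuot_iterate {g : ℝ → ℂ} (hg : LocInt g) (s : ℝ) (n : ℕ) :
    LocInt ((DerivativeSampling.diffQuot s)^[n] g) := by
  induction n with
  | zero => exact hg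
  | succ n ih => rw [Function.iterate_succ_apply']; exact ih.diffQuot s

theorem LocInt.avg_iterate {g : ℝ → ℂ} (hg : LocInt g) (s : ℝ) (n : ℕ) :
    LocInt ((DerivativeSampling.avg s)^[n] g) := by
  induction n with
  | zero => exact hg
  | succ n ih => rw [Function.iterate_succ_apply']; exact ih.avg s

theorem diffQuot_iterate_avg {g : ℝ → ℂ} (hg : LocInt g) (s : ℝ) (n : ℕ) :
    (diffQuot s)^[n] (avg s g) = avg s ((diffQuot s)^[n] g) := by
  induction n with
  | zero => rfl
  | succ n ih =>
    rw [Function.iterate_succ_apply', ih, avg_diffQuot (hg.diffQuot_iterate s n),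
      Function.iterate_succ_apply']

theorem hasDerivAt_diffQuot_iterate (s : ℝ) (n : ℕ) : ∀ {g g' : ℝ → ℂ},
    (∀ t, HasDerivAt g (g' t) t) → ∀ t,
      HasDerivAt ((diffQuot s)^[n] g) ((diffQuot s)^[n] g' t) t := by
  induction n with
  | zero => exact fun h => h
  | succ n ih =>
    intro g g' h
    rw [Function.iterate_succ_apply, Function.iterate_succ_apply]
    refine ih fun t => ?_
    exact (((h (t + s)).comp_add_const t s).sub (h t)).div_const _

theorem diffQuot_iterate_eq (s : ℝ) (n : ℕ) (g : ℝ → ℂ) (t : ℝ) :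
    (diffQuot s)^[n] g t = forwardDiff n s g t / (s : ℂ) ^ n := by
  have h : ∀ n t, (diffQuot s)^[n] g t = (fwdDiff s)^[n] g t / (s : ℂ) ^ n := by
    intro n
    induction n with
    | zero => simp
    | succ n ih =>
      intro t
      rw [Function.iterate_succ_apply', Function.iterate_succ_apply', diffQuot, fwdDiff, ih, ih,
        pow_succ, ← sub_div, div_div]
  rw [h, fwdDiff_iter_eq_sum_shift, forwardDiff]
  congr 1
  refine Finset.sum_congr rfl fun k _ => ?_
  simp

/-- The n-fold average of F_j is its mean at t + s_j(u_1+…+u_n) over the unit cube. All `j` share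
the same u = u_1+…+u_n in [0,n], so a bound for each `u` passes to the mean. -/
theorem norm_sum_avg_iterate_le (J : Finset ℕ) (c : ℕ → ℂ) (s : ℕ → ℝ) (t η : ℝ) (n : ℕ) :
    ∀ F : ℕ → ℝ → ℂ, (∀ j, LocInt (F j)) →
      (∀ u ∈ Set.Icc (0 : ℝ) n, ‖∑ j ∈ J, c j * F j (t + s j * u)‖ ≤ η) →
      ‖∑ j ∈ J, c j * (avg (s j))^[n] (F j) t‖ ≤ η := by
  induction n with
  | zero =>
    intro F _ h
    simpa using h 0 (by simp)
  | succ n ih =>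
    intro F hF h
    simp only [Function.iterate_succ_apply]
    refine ih (fun j => avg (s j) (F j)) (fun j => (hF j).avg _) fun u hu => ?_
    have e : ∑ j ∈ J, c j * avg (s j) (F j) (t + s j * u) =
        ∫ w in (0 : ℝ)..1, ∑ j ∈ J, c j * F j (t + s j * u + s j * w) := by
      rw [intervalIntegral.integral_finsetSum fun j _ =>
        ((hF j).comp_affine (t + s j * u) (s j) 0 1).const_mul _]
      simp only [intervalIntegral.integral_const_mul, avg]
    rw [e]
    refine (intervalIntegral.norm_integral_le_of_norm_le_const (C := η) fun w hw => ?_).trans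
      (by simp)
    rw [Set.uIoc_of_le zero_le_one] at hw
    have h1 := h (u + w) ⟨by linarith [hu.1, hw.1], by push_cast; linarith [hu.2, hw.2]⟩
    simpa only [mul_add, ← add_assoc] using h1

theorem sum_choose_succ_le (r : ℕ) :
    ∑ j ∈ Finset.range r, (r.choose (j + 1) : ℝ) ≤ 2 ^ r := by
  have h := Nat.sum_range_choose r
  rw [Finset.sum_range_succ'] at h
  have : ∑ j ∈ Finset.range r, r.choose (j + 1) ≤ 2 ^ r := by omega
  exact_mod_cast this

theorem neg_one_pow_mul_self (r : ℕ) : (-1 : ℂ) ^ r * (-1) ^ r = 1 := by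
  rw [← mul_pow]; simp

/-- A bounded-order smoothing of `f` whose error and whose `r`-th derivative are controlled by
the local differences of `f` of order `r`. -/
theorem exists_smoothing (r : ℕ) {d : ℝ} (hd : 0 < d) {f : ℝ → ℂ} (hf : LocInt f) :
    ∃ G : ℕ → ℝ → ℂ, (∀ i < r, ∀ x, HasDerivAt (G i) (G (i + 1) x) x) ∧
      ∀ x η : ℝ, (∀ y h : ℝ, x ≤ y → 0 ≤ h → y + r * h ≤ x + r * (r + 1) * d →
        ‖forwardDiff r h f y‖ ≤ η) →
        ‖f x - G 0 x‖ ≤ η ∧ ‖G r x‖ ≤ 2 ^ r * (d ^ r)⁻¹ * η := by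
  set c : ℕ → ℂ := fun j => (-1 : ℂ) ^ (r - j) * (r.choose j : ℂ) with hc
  have hcn : ∀ j, ‖c j‖ = (r.choose j : ℝ) := fun j => by simp [hc]
  set s : ℕ → ℝ := fun j => (j : ℝ) * d with hs
  have hsne : ∀ j, s (j + 1) ≠ 0 := fun j => by
    simp only [hs]; positivity
  -- Since s_0 = 0, the term j = 0 of the averaged difference ∑ c_j avg^(r+1) f is (-1)^r f(x); `G
  -- 0` is the rest, with the sign that makes f - G_0 equal to (-1)^r times the averaged difference.
  -- Each differentiation turns one average into a difference quotient.
  refine ⟨fun i x => -(-1) ^ r * ∑ j ∈ Finset.range r,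
    c (j + 1) * (diffQuot (s (j + 1)))^[i] ((avg (s (j + 1)))^[r + 1 - i] f) x, ?_, ?_⟩
  · intro i hi x
    refine HasDerivAt.const_mul _ (HasDerivAt.fun_sum fun j _ => HasDerivAt.const_mul _ ?_)
    -- For i < r at least two averages remain: the inner one makes the function continuous, the
    -- outer one is differentiated. This is why r+1 averages are taken.
    have e1 : r + 1 - i = (r - i - 1) + 1 + 1 := by omega
    have e2 : r + 1 - (i + 1) = (r - i - 1) + 1 := by omega
    rw [e1, e2, Function.iterate_succ_apply (diffQuot (s (j + 1))) i]
    refine hasDerivAt_diffQuot_iterate _ _ (fun t => ?_) x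
    rw [Function.iterate_succ_apply']
    refine hasDerivAt_avg (hsne j) ?_ t
    rw [Function.iterate_succ_apply']
    exact continuous_avg (hsne j) (hf.avg_iterate _ _)
  · intro x η h
    have hη : 0 ≤ η := (norm_nonneg _).trans (h x 0 le_rfl le_rfl (by
      have : 0 ≤ (r : ℝ) * (r + 1) * d := by positivity
      linarith))
    constructor
    · have h1 : ‖∑ j ∈ Finset.range (r + 1), c j * (avg (s j))^[r + 1] f x‖ ≤ η := by
        refine norm_sum_avg_iterate_le _ c s x η (r + 1) (fun _ => f) (fun _ => hf)
          fun u hu => ?_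
        have h2 := h x (d * u) le_rfl (mul_nonneg hd.le hu.1) (by
          have h3 := hu.2
          push_cast at h3
          have : (r : ℝ) * (d * u) ≤ r * (d * (r + 1)) := by gcongr
          linarith)
        convert h2 using 2
        rw [forwardDiff]
        refine Finset.sum_congr rfl fun j _ => ?_
        simp only [hc, hs, mul_assoc]
      have e : f x - (-(-1) ^ r * ∑ j ∈ Finset.range r,
          c (j + 1) * (diffQuot (s (j + 1)))^[0] ((avg (s (j + 1)))^[r + 1 - 0] f) x) =
          (-1) ^ r * ∑ j ∈ Finset.range (r + 1), c j * (avg (s j))^[r + 1] f x := by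
        rw [Finset.sum_range_succ', mul_add]
        have e0 : (avg (s 0))^[r + 1] f x = f x := by
          have : avg (s 0) = id := by
            funext g
            simp only [hs, Nat.cast_zero, zero_mul, avg_zero, id]
          rw [this, Function.iterate_id, id]
        have ec : c 0 = (-1) ^ r := by simp [hc]
        rw [e0, ec, ← mul_assoc ((-1 : ℂ) ^ r) ((-1) ^ r), neg_one_pow_mul_self]
        simp only [Function.iterate_zero, id, Nat.sub_zero]
        ring
      simp only at e ⊢
      rw [e, norm_mul]
      simpa using h1
    · simp only
      rw [norm_mul]
      have e1 : ‖-(-1 : ℂ) ^ r‖ = 1 := by simp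
      rw [e1, one_mul]
      -- At order r a single average is left, of Δ_s^r f / s^r with s = (j+1)d between d and rd. The
      -- nodes stay within rd + r·rd = r(r+1)d to the right of x.
      have key : ∀ j ∈ Finset.range r, ‖c (j + 1) *
          (diffQuot (s (j + 1)))^[r] ((avg (s (j + 1)))^[r + 1 - r] f) x‖ ≤
          (r.choose (j + 1) : ℝ) * ((d ^ r)⁻¹ * η) := by
        intro j hj
        rw [norm_mul, hcn, Nat.add_sub_cancel_left, Function.iterate_one,
          diffQuot_iterate_avg hf]
        refine mul_le_mul_of_nonneg_left ?_ (by positivity)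
        refine (intervalIntegral.norm_integral_le_of_norm_le_const (C := (d ^ r)⁻¹ * η)
          fun w hw => ?_).trans (by simp)
        rw [Set.uIoc_of_le zero_le_one] at hw
        rw [diffQuot_iterate_eq, norm_div, norm_pow, Complex.norm_real]
        have hjr : ((j + 1 : ℕ) : ℝ) ≤ r := by
          exact_mod_cast Finset.mem_range.1 hj
        have hsd : d ≤ s (j + 1) := by
          simp only [hs]; push_cast
          nlinarith [(Nat.cast_nonneg j : (0 : ℝ) ≤ j)]
        have hsr : s (j + 1) ≤ r * d := by
          simp only [hs]; gcongr
        have hs0 : 0 ≤ s (j + 1) := hd.le.trans hsd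
        rw [Real.norm_of_nonneg hs0, div_eq_inv_mul]
        have h4 := h (x + s (j + 1) * w) (s (j + 1))
          (by linarith [mul_nonneg hs0 hw.1.le]) hs0 (by
            have h5 : s (j + 1) * w ≤ s (j + 1) := mul_le_of_le_one_right hs0 hw.2
            have h6 : (r : ℝ) * s (j + 1) ≤ r * (r * d) := by gcongr
            linarith)
        gcongr
      refine (norm_sum_le_of_le _ key).trans ?_
      rw [← Finset.sum_mul, mul_assoc]
      exact mul_le_mul_of_nonneg_right (sum_choose_succ_le r) (by positivity)

/-! ### Taylor polynomials -/

/-- The derivative of the remainder is the remainder of one order less for the shifted family, so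
the mean value inequality drives an induction. It loses the factor 1/n!, which is not needed. -/
theorem norm_sub_taylor_le (n : ℕ) (t M : ℝ) : ∀ (G : ℕ → ℝ → ℂ),
    (∀ i < n, ∀ x, HasDerivAt (G i) (G (i + 1) x) x) → ∀ s : ℝ,
    (∀ x ∈ Set.uIcc t s, ‖G n x‖ ≤ M) →
    ‖G 0 s - ∑ i ∈ Finset.range n, G i t / (i.factorial : ℂ) * ((s : ℂ) - t) ^ i‖ ≤
      M * |s - t| ^ n := by
  induction n with
  | zero =>
    intro G _ s h
    simpa using h s Set.right_mem_uIcc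
  | succ n ih =>
    intro G hG s h
    have hM : 0 ≤ M := (norm_nonneg _).trans (h s Set.right_mem_uIcc)
    set H : ℝ → ℂ := fun x =>
      G 0 x - ∑ i ∈ Finset.range (n + 1), G i t / (i.factorial : ℂ) * ((x : ℂ) - t) ^ i with hH
    have hder : ∀ x : ℝ, HasDerivAt H (G 1 x -
        ∑ i ∈ Finset.range n, G (i + 1) t / (i.factorial : ℂ) * ((x : ℂ) - t) ^ i) x := by
      intro x
      refine (hG 0 n.succ_pos x).sub ?_
      simp only [Finset.sum_range_succ' _ n]
      rw [← add_zero (∑ i ∈ Finset.range n, _)]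
      refine HasDerivAt.add (HasDerivAt.fun_sum fun i _ => ?_) ?_
      · have h1 : HasDerivAt (fun x : ℝ => (x : ℂ) - t) 1 x :=
          (Complex.ofRealCLM.hasDerivAt (x := x)).sub_const _
        have h2 := (h1.fun_pow (i + 1)).const_mul (G (i + 1) t / ((i + 1).factorial : ℂ))
        refine h2.congr_deriv ?_
        rw [Nat.factorial_succ, Nat.add_sub_cancel]
        have : (i.factorial : ℂ) ≠ 0 := by exact_mod_cast i.factorial_ne_zero
        have : ((i : ℂ) + 1) ≠ 0 := by exact_mod_cast i.succ_ne_zero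
        push_cast
        field_simp
      · simpa using hasDerivAt_const x (G 0 t)
    have hb : ∀ x ∈ Set.uIcc t s, ‖G 1 x -
        ∑ i ∈ Finset.range n, G (i + 1) t / (i.factorial : ℂ) * ((x : ℂ) - t) ^ i‖ ≤
        M * |s - t| ^ n := by
      intro x hx
      refine (ih (fun i => G (i + 1)) (fun i hi => hG (i + 1) (by omega)) x fun y hy => ?_).trans ?_
      · exact h y (Set.uIcc_subset_uIcc_left hx hy)
      · have := Set.abs_sub_left_of_mem_uIcc hx
        gcongr
    have h3 := (convex_uIcc t s).norm_image_sub_le_of_norm_hasDerivWithin_le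
      (fun x _ => (hder x).hasDerivWithinAt) hb Set.left_mem_uIcc Set.right_mem_uIcc
    have h0 : H t = 0 := by
      simp only [hH, Finset.sum_range_succ' _ n]
      simp
    rw [h0, sub_zero, Real.norm_eq_abs] at h3
    rw [pow_succ, ← mul_assoc]
    exact h3

theorem exists_local_polynomial {r : ℕ} (hr : 1 ≤ r) {d : ℝ} (hd : 0 < d) {f : ℝ → ℂ}
    (hf : LocInt f) :
    ∃ P : ℝ → ℂ[X], (∀ t, (P t).natDegree < r) ∧ ∀ t y η : ℝ,
      (∀ x ∈ Set.uIcc t y, ∀ z h : ℝ, x ≤ z → 0 ≤ h → z + r * h ≤ x + r * (r + 1) * d →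
        ‖forwardDiff r h f z‖ ≤ η) →
      ‖f y - (P t).eval (y : ℂ)‖ ≤ η * (1 + 2 ^ r * (|y - t| / d) ^ r) := by
  obtain ⟨G, hG, hb⟩ := exists_smoothing r hd hf
  refine ⟨fun t => ∑ i ∈ Finset.range r,
    Polynomial.C (G i t / (i.factorial : ℂ)) * (Polynomial.X - Polynomial.C (t : ℂ)) ^ i,
    fun t => ?_, fun t y η h => ?_⟩
  · refine lt_of_le_of_lt (b := r - 1) ?_ (by omega)
    refine Polynomial.natDegree_sum_le_of_forall_le _ _ fun i hi => ?_
    refine (Polynomial.natDegree_C_mul_le _ _).trans ?_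
    refine Polynomial.natDegree_pow_le.trans ?_
    have := Finset.mem_range.1 hi
    rw [Polynomial.natDegree_X_sub_C]
    omega
  · have h1 := (hb y η (h y Set.right_mem_uIcc)).1
    have h2 := norm_sub_taylor_le r t (2 ^ r * (d ^ r)⁻¹ * η) G hG y
      fun x hx => (hb x η (h x hx)).2
    have e : f y - (∑ i ∈ Finset.range r, Polynomial.C (G i t / (i.factorial : ℂ)) *
        (Polynomial.X - Polynomial.C (t : ℂ)) ^ i).eval (y : ℂ) = (f y - G 0 y) + (G 0 y -
        ∑ i ∈ Finset.range r, G i t / (i.factorial : ℂ) * ((y : ℂ) - t) ^ i) := by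
      simp [Polynomial.eval_finsetSum]
    simp only
    rw [e]
    refine (norm_add_le _ _).trans ((add_le_add h1 h2).trans (le_of_eq ?_))
    rw [div_pow]
    field_simp

/-! ### Forward differences and derivatives -/

theorem forwardDiff_polynomial {r : ℕ} {P : ℂ[X]} (hP : P.natDegree < r) (h t : ℝ) :
    forwardDiff r h (fun x : ℝ => P.eval (x : ℂ)) t = 0 := by
  set Q : ℂ[X] := P.comp (Polynomial.C (t : ℂ) + Polynomial.C (h : ℂ) * Polynomial.X) with hQ
  have hdeg : Q.natDegree < r := by
    refine lt_of_le_of_lt ?_ hP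
    refine Polynomial.natDegree_comp_le.trans ?_
    refine (Nat.mul_le_mul_left _ (?_ : _ ≤ 1)).trans (by simp)
    compute_degree
  have h0 := congrFun (Polynomial.fwdDiff_iter_eq_zero_of_degree_lt hdeg) 0
  rw [fwdDiff_iter_eq_sum_shift] at h0
  rw [forwardDiff]
  refine Eq.trans (Finset.sum_congr rfl fun j _ => ?_) h0
  have e : ((t + (j : ℝ) * h : ℝ) : ℂ) = t + h * (0 + j • (1 : ℂ)) := by
    push_cast
    rw [nsmul_eq_mul]
    ring
  rw [e]
  simp [hQ]

theorem forwardDiff_sub (r : ℕ) (h : ℝ) (f g : ℝ → ℂ) (t : ℝ) :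
    forwardDiff r h (fun x => f x - g x) t = forwardDiff r h f t - forwardDiff r h g t := by
  simp only [forwardDiff, mul_sub, Finset.sum_sub_distrib]

theorem iteratedDeriv_polynomial (P : ℂ[X]) (i : ℕ) :
    iteratedDeriv i (fun s : ℝ => P.eval (s : ℂ)) =
      fun s : ℝ => (Polynomial.derivative^[i] P).eval (s : ℂ) := by
  induction i with
  | zero => simp
  | succ i ih =>
    rw [iteratedDeriv_succ, ih]
    ext s
    rw [Function.iterate_succ_apply']
    exact ((Polynomial.hasDerivAt (Polynomial.derivative^[i] P) (s : ℂ)).comp_ofReal).deriv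

/-- A bound for a derivative by the function and by the differences of the derivative. -/
theorem norm_deriv_le_of_forwardDiff {u v : ℝ → ℂ} (huv : ∀ x, HasDerivAt u (v x) x) {r : ℕ}
    {d : ℝ} (hd : 0 < d) {x M η : ℝ}
    (hM : ∀ y ∈ Set.Icc x (x + r * d), ‖u y‖ ≤ M)
    (hη : ∀ h ∈ Set.Icc 0 d, ‖forwardDiff r h v x‖ ≤ η) :
    d * ‖v x‖ ≤ d * η + 2 ^ (r + 1) * M := by
  set c : ℕ → ℂ := fun j => (-1 : ℂ) ^ (r - j) * (r.choose j : ℂ) with hc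
  have hM0 : 0 ≤ M := (norm_nonneg _).trans (hM x ⟨le_rfl, by
    have : 0 ≤ (r : ℝ) * d := by positivity
    linarith⟩)
  -- An antiderivative of h ↦ Δ_h^r v(x). The node j = 0 contributes ± h v(x) and the others only
  -- values of `u`, so the increment over [0,d] isolates d v(x).
  set G : ℝ → ℂ := fun h => ∑ j ∈ Finset.range r,
    c (j + 1) * (u (x + (j + 1 : ℕ) * h) / ((j + 1 : ℕ) : ℂ)) + c 0 * (v x * h) with hG
  have hder : ∀ h : ℝ, HasDerivAt G (forwardDiff r h v x) h := by
    intro h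
    rw [forwardDiff, Finset.sum_range_succ']
    refine HasDerivAt.add (HasDerivAt.fun_sum fun j _ => HasDerivAt.const_mul _ ?_)
      (HasDerivAt.const_mul _ ?_)
    · have h1 : HasDerivAt (fun h : ℝ => x + (j + 1 : ℕ) * h) ((j + 1 : ℕ) : ℝ) h := by
        simpa using ((hasDerivAt_id h).const_mul (((j + 1 : ℕ) : ℝ))).const_add x
      have h2 := ((huv (x + (j + 1 : ℕ) * h)).scomp h h1).div_const ((j + 1 : ℕ) : ℂ)
      refine h2.congr_deriv ?_
      have : ((j : ℂ) + 1) ≠ 0 := by exact_mod_cast j.succ_ne_zero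
      simp only [Complex.real_smul]
      push_cast
      field_simp
    · have := (Complex.ofRealCLM.hasDerivAt (x := h)).const_mul (v x)
      simpa using this
  have h3 := (convex_Icc 0 d).norm_image_sub_le_of_norm_hasDerivWithin_le
    (fun h _ => (hder h).hasDerivWithinAt) hη (Set.left_mem_Icc.2 hd.le)
    (Set.right_mem_Icc.2 hd.le)
  rw [sub_zero, Real.norm_of_nonneg hd.le] at h3
  have e : c 0 * (v x * d) = (G d - G 0) - ∑ j ∈ Finset.range r,
      c (j + 1) * ((u (x + (j + 1 : ℕ) * d) - u x) / ((j + 1 : ℕ) : ℂ)) := by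
    simp only [hG, sub_div, mul_sub, Finset.sum_sub_distrib]
    simp
  have h4 : ‖c 0 * (v x * d)‖ = d * ‖v x‖ := by
    simp [hc, abs_of_pos hd, mul_comm]
  have h5 : ‖∑ j ∈ Finset.range r,
      c (j + 1) * ((u (x + (j + 1 : ℕ) * d) - u x) / ((j + 1 : ℕ) : ℂ))‖ ≤ 2 ^ (r + 1) * M := by
    have key : ∀ j ∈ Finset.range r,
        ‖c (j + 1) * ((u (x + (j + 1 : ℕ) * d) - u x) / ((j + 1 : ℕ) : ℂ))‖ ≤
          (r.choose (j + 1) : ℝ) * (2 * M) := by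
      intro j hj
      have hjr : ((j + 1 : ℕ) : ℝ) ≤ r := by exact_mod_cast Finset.mem_range.1 hj
      have hcn : ‖c (j + 1)‖ = (r.choose (j + 1) : ℝ) := by simp [hc]
      rw [norm_mul, hcn, norm_div, Complex.norm_natCast]
      refine mul_le_mul_of_nonneg_left ?_ (by positivity)
      have h6 : 0 ≤ ((j + 1 : ℕ) : ℝ) * d := by positivity
      have h7 : ((j + 1 : ℕ) : ℝ) * d ≤ r * d := by gcongr
      have h8 := hM (x + (j + 1 : ℕ) * d) ⟨by linarith, by linarith⟩
      have h9 := hM x ⟨le_rfl, by linarith⟩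
      have h10 := norm_sub_le (u (x + (j + 1 : ℕ) * d)) (u x)
      have h11 : (1 : ℝ) ≤ ((j + 1 : ℕ) : ℝ) := by push_cast; linarith [(Nat.cast_nonneg j : (0:ℝ) ≤ j)]
      refine (div_le_self (norm_nonneg _) h11).trans ?_
      linarith
    refine (norm_sum_le_of_le _ key).trans ?_
    rw [← Finset.sum_mul, pow_succ, mul_assoc]
    exact mul_le_mul_of_nonneg_right (sum_choose_succ_le r) (by positivity)
  rw [← h4, e]
  refine (norm_sub_le _ _).trans ?_
  linarith

/-- Iterates the one-derivative bound. Each order consumes a length rd to the right, whence the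
initial interval of length q·rd, and costs a factor 2^(r+1)+1. -/
theorem norm_iterated_le_of_forwardDiff {u : ℕ → ℝ → ℂ} {q : ℕ}
    (hu : ∀ i < q, ∀ x, HasDerivAt (u i) (u (i + 1) x) x) {r : ℕ} {d : ℝ} (hd : 0 < d)
    {x M : ℝ} {e : ℕ → ℝ} (he : ∀ i, 0 ≤ e i)
    (hM : ∀ y ∈ Set.Icc x (x + q * (r * d)), ‖u 0 y‖ ≤ M)
    (hη : ∀ i ≤ q, ∀ y ∈ Set.Icc x (x + q * (r * d)), ∀ h ∈ Set.Icc 0 d,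
      ‖forwardDiff r h (u i) y‖ ≤ e i) (i : ℕ) : i ≤ q → ∀ y, x ≤ y →
      y + i * (r * d) ≤ x + q * (r * d) →
      d ^ i * ‖u i y‖ ≤ (2 ^ (r + 1) + 1) ^ i * (M + ∑ j ∈ Finset.range (i + 1), d ^ j * e j) := by
  induction i with
  | zero =>
    intro _ y hy hy'
    have h1 := hM y ⟨hy, by simpa using hy'⟩
    simp only [pow_zero, one_mul, zero_add, Finset.sum_range_one]
    linarith [he 0]
  | succ i ih =>
    intro hi y hy hy'
    have hrd : 0 ≤ (r : ℝ) * d := by positivity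
    push_cast at hy'
    set B := M + ∑ j ∈ Finset.range (i + 1), d ^ j * e j with hB
    have hyi : y ∈ Set.Icc x (x + q * (r * d)) := ⟨hy, by
      have : 0 ≤ ((i : ℝ) + 1) * (r * d) := by positivity
      linarith⟩
    have hM0 : 0 ≤ M := (norm_nonneg _).trans (hM y hyi)
    have hB0 : 0 ≤ B := add_nonneg hM0 (Finset.sum_nonneg fun j _ =>
      mul_nonneg (pow_nonneg hd.le _) (he j))
    have h1 := norm_deriv_le_of_forwardDiff (hu i (by omega)) hd (x := y) (r := r)
      (M := (d ^ i)⁻¹ * ((2 ^ (r + 1) + 1) ^ i * B)) (η := e (i + 1))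
      (fun z hz => by
        rw [le_inv_mul_iff₀ (by positivity)]
        exact ih (by omega) z (hy.trans hz.1) (by linarith [hz.2]))
      (fun h hh => hη (i + 1) hi y hyi h hh)
    rw [Finset.sum_range_succ, ← add_assoc, ← hB]
    have hK : (1 : ℝ) ≤ (2 ^ (r + 1) + 1) ^ i := one_le_pow₀ (by
      have : (0 : ℝ) ≤ 2 ^ (r + 1) := by positivity
      linarith)
    have hde : 0 ≤ d ^ (i + 1) * e (i + 1) := mul_nonneg (pow_nonneg hd.le _) (he _)
    have hK' : (1 : ℝ) ≤ (2 ^ (r + 1) + 1) ^ (i + 1) := one_le_pow₀ (by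
      have : (0 : ℝ) ≤ 2 ^ (r + 1) := by positivity
      linarith)
    calc d ^ (i + 1) * ‖u (i + 1) y‖ = d ^ i * (d * ‖u (i + 1) y‖) := by ring
      _ ≤ d ^ i * (d * e (i + 1) +
          2 ^ (r + 1) * ((d ^ i)⁻¹ * ((2 ^ (r + 1) + 1) ^ i * B))) := by gcongr
      _ = d ^ (i + 1) * e (i + 1) + 2 ^ (r + 1) * ((2 ^ (r + 1) + 1) ^ i * B) := by
        field_simp
        ring
      _ ≤ (2 ^ (r + 1) + 1) ^ (i + 1) * (d ^ (i + 1) * e (i + 1)) +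
          (2 ^ (r + 1) + 1) * ((2 ^ (r + 1) + 1) ^ i * B) := by
        refine add_le_add (le_mul_of_one_le_left hde hK') ?_
        gcongr
        linarith
      _ = _ := by ring

/-! ### Local approximation by polynomials on cells -/

/-- Only moduli of cells between `n` and `k` may enter the estimate, so points beyond the last cell
are attributed to that cell, stretched to length bd. -/
theorem exists_mem_uIcc_cell {d b : ℝ} (hd : 0 < d) (hb : 1 ≤ b) {n k : ℤ} {x : ℝ}
    (h1 : (min n k : ℤ) * d ≤ x) (h2 : x ≤ ((max n k : ℤ) + b) * d) :
    ∃ m ∈ Finset.uIcc n k, (m : ℝ) * d ≤ x ∧ x ≤ (m + b) * d := by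
  by_cases hx : ((max n k : ℤ) : ℝ) * d ≤ x
  · exact ⟨max n k, by simp [Finset.mem_uIcc], hx, h2⟩
  · rw [not_le] at hx
    have a1 : ((min n k : ℤ) : ℝ) ≤ x / d := by rwa [le_div_iff₀ hd]
    have a2 : x / d < ((max n k : ℤ) : ℝ) := by rwa [div_lt_iff₀ hd]
    refine ⟨⌊x / d⌋, Finset.mem_uIcc.2 ⟨Int.le_floor.2 a1, ?_⟩, ?_, ?_⟩
    · exact (Int.floor_lt.2 a2).le
    · rw [← le_div_iff₀ hd]; exact Int.floor_le _
    · rw [← div_le_iff₀ hd]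
      linarith [Int.lt_floor_add_one (x / d)]

theorem exists_simultaneous_approximation {ρ r : ℕ} (hρ : 1 ≤ ρ) (hr : 1 ≤ r) :
    ∃ C L : ℝ, 0 ≤ C ∧ 1 ≤ L ∧ ∀ (d : ℝ) (_ : 0 < d) (f : ℝ → ℂ) (_ : LocInt f)
      (_ : ∀ i : ℕ, i + 1 < ρ → Differentiable ℝ (iteratedDeriv i f))
      (e : ℕ → ℤ → ℝ) (_ : ∀ i k, 0 ≤ e i k)
      (_ : ∀ i < ρ, ∀ (k : ℤ) (y h : ℝ), k * d ≤ y → 0 ≤ h → y + r * h ≤ (k + L) * d →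
        ‖forwardDiff r h (iteratedDeriv i f) y‖ ≤ e i k),
      ∃ P : ℝ → ℂ[X], (∀ t, (P t).natDegree ≤ r) ∧
        ∀ (n k : ℤ) (t s : ℝ), n * d ≤ t → t ≤ (n + 1) * d → k * d ≤ s → s ≤ (k + 1) * d →
          ∀ i < ρ, d ^ i * ‖iteratedDeriv i f s -
            iteratedDeriv i (fun x : ℝ => (P t).eval (x : ℂ)) s‖ ≤
            C * (1 + |(n : ℝ) - k|) ^ r *
              ∑ m ∈ Finset.uIcc n k, ∑ j ∈ Finset.range ρ, d ^ j * e j m := by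
  obtain ⟨q, rfl⟩ : ∃ q, ρ = q + 1 := ⟨ρ - 1, by omega⟩
  set K : ℝ := 2 ^ (r + 1) + 1 with hK
  have hK1 : 1 ≤ K := by
    have : (0 : ℝ) ≤ 2 ^ (r + 1) := by positivity
    linarith
  set b : ℝ := 1 + q * r with hbdef
  have hb1 : 1 ≤ b := by
    have : (0 : ℝ) ≤ q * r := by positivity
    linarith
  have hr1 : (1 : ℝ) ≤ r := by exact_mod_cast hr
  -- In units of d, b is one cell plus the room qr for passing to the derivatives, and r(r+1) is the
  -- reach of the smoothing. In the constant, 1 + (2b)^r comes from f - P and the other 1 from the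
  -- differences of the derivatives.
  refine ⟨K ^ q * (2 + (2 * b) ^ r), b + r * (r + 1), by positivity, by nlinarith, ?_⟩
  intro d hd f hf hdiff e he hω
  obtain ⟨P, hPdeg, hP⟩ := exists_local_polynomial hr hd hf
  refine ⟨P, fun t => (hPdeg t).le, fun n k t s ht ht' hs hs' i hi => ?_⟩
  set E : ℤ → ℝ := fun m => ∑ j ∈ Finset.range (q + 1), d ^ j * e j m with hE
  have hE0 : ∀ m, 0 ≤ E m := fun m => Finset.sum_nonneg fun j _ =>
    mul_nonneg (pow_nonneg hd.le _) (he j m)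
  set A := ∑ m ∈ Finset.uIcc n k, E m with hA
  have hEA : ∀ m ∈ Finset.uIcc n k, E m ≤ A := fun m hm =>
    Finset.single_le_sum (f := E) (fun m _ => hE0 m) hm
  have hA0 : 0 ≤ A := Finset.sum_nonneg fun m _ => hE0 m
  have he0 : ∀ m, e 0 m ≤ E m := fun m => by
    have := Finset.single_le_sum (f := fun j => d ^ j * e j m) (s := Finset.range (q + 1))
      (fun j _ => mul_nonneg (pow_nonneg hd.le _) (he j m)) (Finset.mem_range.2 q.succ_pos)
    simpa using this
  set D := 1 + |(n : ℝ) - k| with hD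
  have hD1 : 1 ≤ D := by linarith [abs_nonneg ((n : ℝ) - k)]
  have hminn : ((min n k : ℤ) : ℝ) ≤ n := by exact_mod_cast min_le_left n k
  have hmink : ((min n k : ℤ) : ℝ) ≤ k := by exact_mod_cast min_le_right n k
  have hmaxn : (n : ℝ) ≤ ((max n k : ℤ) : ℝ) := by exact_mod_cast le_max_left n k
  have hmaxk : (k : ℝ) ≤ ((max n k : ℤ) : ℝ) := by exact_mod_cast le_max_right n k
  have hsb : s + q * (r * d) ≤ (k + b) * d := by rw [hbdef]; linarith
  have hM : ∀ y ∈ Set.Icc s (s + q * (r * d)), ‖f y - (P t).eval (y : ℂ)‖ ≤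
      A * ((1 + (2 * b) ^ r) * D ^ r) := by
    intro y hy
    have hyk : y ≤ (k + b) * d := hy.2.trans hsb
    refine (hP t y A fun x hx z h hxz hh hz => ?_).trans (mul_le_mul_of_nonneg_left ?_ hA0)
    · rw [Set.uIcc, Set.mem_Icc] at hx
      obtain ⟨m, hm, hm1, hm2⟩ := exists_mem_uIcc_cell (n := n) (k := k) (x := x) hd hb1 (by
          refine le_trans (le_min ?_ ?_) hx.1
          · exact le_trans (by gcongr) ht
          · exact le_trans (le_trans (by gcongr) hs) hy.1) (by
          refine hx.2.trans (max_le ?_ ?_)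
          · exact ht'.trans (by gcongr)
          · exact hyk.trans (by gcongr))
      have h0 := hω 0 q.succ_pos m z h (hm1.trans hxz) hh (by linarith)
      rw [iteratedDeriv_zero] at h0
      exact h0.trans ((he0 m).trans (hEA m hm))
    · have h1 : |y - t| / d ≤ b * D := by
        rw [div_le_iff₀ hd, abs_le]
        have h2 : k * d - (n + 1) * d ≤ y - t := by linarith [hy.1]
        have h3 : y - t ≤ (k + b) * d - n * d := by linarith
        have h4 := neg_abs_le ((n : ℝ) - k)
        have h5 := le_abs_self ((n : ℝ) - k)
        have h6 : D ≤ b * D := le_mul_of_one_le_left (by linarith) hb1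
        have h7 : b + |(n : ℝ) - k| ≤ b * D := by
          rw [hD]; nlinarith [abs_nonneg ((n : ℝ) - k)]
        constructor
        · have : (n : ℝ) + 1 - k ≤ b * D := by linarith
          have := mul_le_mul_of_nonneg_right this hd.le
          linarith
        · have : (k : ℝ) + b - n ≤ b * D := by linarith
          have := mul_le_mul_of_nonneg_right this hd.le
          linarith
      have h2 : (|y - t| / d) ^ r ≤ (b * D) ^ r := by gcongr
      have h3 : 1 ≤ D ^ r := one_le_pow₀ hD1
      calc 1 + 2 ^ r * (|y - t| / d) ^ r ≤ D ^ r + 2 ^ r * (b * D) ^ r := by gcongr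
        _ = _ := by rw [mul_pow, mul_pow]; ring
  have key := norm_iterated_le_of_forwardDiff (q := q) (r := r) (x := s)
    (u := fun i x => iteratedDeriv i f x - iteratedDeriv i (fun x : ℝ => (P t).eval (x : ℂ)) x)
    (e := fun j => e j k) (fun i hi x => by
      refine HasDerivAt.sub ?_ ?_
      · rw [iteratedDeriv_succ]
        exact (hdiff i (by omega) x).hasDerivAt
      · rw [iteratedDeriv_succ]
        refine DifferentiableAt.hasDerivAt ?_
        rw [iteratedDeriv_polynomial]
        exact ((Polynomial.hasDerivAt _ (x : ℂ)).comp_ofReal).differentiableAt)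
    hd (fun j => he j k) (by simpa only [iteratedDeriv_zero] using hM)
    (fun j hj y hy h hh => by
      rw [forwardDiff_sub, iteratedDeriv_polynomial, forwardDiff_polynomial, sub_zero]
      · refine hω j (by omega) k y h (hs.trans hy.1) hh.1 ?_
        have h1 : (r : ℝ) * h ≤ r * d := mul_le_mul_of_nonneg_left hh.2 (by linarith)
        have h2 : (r : ℝ) * d ≤ r * (r + 1) * d := by
          have : (r : ℝ) ≤ r * (r + 1) := by nlinarith
          gcongr
        have := hy.2
        linarith
      · exact (Polynomial.natDegree_iterate_derivative (P t) j).trans_lt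
          (lt_of_le_of_lt (Nat.sub_le _ _) (hPdeg t)))
    i (by omega) s le_rfl (by
      have : (i : ℝ) ≤ q := by exact_mod_cast (by omega : i ≤ q)
      gcongr)
  refine key.trans ?_
  have h1 : ∑ j ∈ Finset.range (i + 1), d ^ j * e j k ≤ A := by
    refine le_trans ?_ (hEA k (by simp))
    exact Finset.sum_le_sum_of_subset_of_nonneg
      (Finset.range_mono (by omega)) fun j _ _ => mul_nonneg (pow_nonneg hd.le _) (he j k)
  have h3 : 1 ≤ D ^ r := one_le_pow₀ hD1
  have h4 : K ^ i ≤ K ^ q := pow_le_pow_right₀ hK1 (by omega)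
  calc K ^ i * (A * ((1 + (2 * b) ^ r) * D ^ r) + ∑ j ∈ Finset.range (i + 1), d ^ j * e j k)
      ≤ K ^ q * (A * ((1 + (2 * b) ^ r) * D ^ r) + A * D ^ r) := by
        have h5 : 0 ≤ ∑ j ∈ Finset.range (i + 1), d ^ j * e j k :=
          Finset.sum_nonneg fun j _ => mul_nonneg (pow_nonneg hd.le _) (he j k)
        exact mul_le_mul h4 (add_le_add le_rfl (h1.trans (le_mul_of_one_le_right hA0 h3)))
          (add_nonneg (by positivity) h5) (by positivity)
    _ = _ := by ring

/-! ### Convergence of the sampling series -/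

/-- Samples of polynomial growth are allowed so that the result covers both `f` (with N = 0) and the
comparison polynomials. -/
theorem summable_samplingTerm {φ : ℝ → ℂ} {a : ℝ} {ρ : ℕ} (hρ : 1 ≤ ρ) {W : ℝ} (hW : 1 ≤ W)
    {N : ℕ} {C : ℝ} (hC : ∀ (i : Fin ρ) (x : ℝ),
      (1 + |x|) ^ (N + 2) * ‖reconstruction φ a ρ i x‖ ≤ C)
    {g : ℝ → ℂ} {t B : ℝ} (hB : ∀ i < ρ, ∀ l : ℤ,
      ‖iteratedDeriv i g ((a + (ρ : ℝ) * (l : ℝ)) / W)‖ ≤ B * (1 + |W * t - ρ * (l : ℝ)|) ^ N) :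
    Summable (samplingTerm φ a ρ W g t) := by
  obtain ⟨_, _, hS⟩ := exists_tsum_inv_one_add_abs_le ρ hρ
  refine Summable.of_norm_bounded ((hS (W * t)).1.mul_left (ρ * (B * C))) fun l => ?_
  set X := 1 + |W * t - ρ * (l : ℝ)| with hX
  have hX0 : 0 < X := by positivity
  have h1 : ∀ i ∈ (Finset.univ : Finset (Fin ρ)), ‖(1 / (W : ℂ) ^ (i : ℕ)) *
      iteratedDeriv (i : ℕ) g ((a + (ρ : ℝ) * (l : ℝ)) / W) *
      reconstruction φ a ρ i (W * t - (ρ : ℝ) * (l : ℝ))‖ ≤ B * C * (X ^ 2)⁻¹ := by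
    intro i _
    have h2 := hB i i.2 l
    have h3 := hC i (W * t - ρ * (l : ℝ))
    rw [← hX] at h2 h3
    have h4 : ‖1 / (W : ℂ) ^ (i : ℕ)‖ ≤ 1 := by
      rw [norm_div, norm_one, norm_pow, Complex.norm_real, Real.norm_of_nonneg (by linarith)]
      exact div_le_one_of_le₀ (one_le_pow₀ hW) (by positivity)
    have hB0 : 0 ≤ B := by
      have := (norm_nonneg _).trans h2
      exact nonneg_of_mul_nonneg_left this (by positivity)
    rw [norm_mul, norm_mul, ← div_eq_mul_inv, le_div_iff₀ (by positivity)]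
    calc _ ≤ 1 * (B * X ^ N) * ‖reconstruction φ a ρ i (W * t - (ρ : ℝ) * (l : ℝ))‖ * X ^ 2 := by
          gcongr
      _ = B * (X ^ (N + 2) * ‖reconstruction φ a ρ i (W * t - (ρ : ℝ) * (l : ℝ))‖) := by ring
      _ ≤ _ := by gcongr
  refine (norm_sum_le_of_le _ h1).trans (le_of_eq ?_)
  simp [mul_assoc]

theorem exists_polynomial_growth (P : ℂ[X]) : ∃ (C : ℝ) (N : ℕ), 0 ≤ C ∧ ∀ x : ℝ,
    ‖P.eval (x : ℂ)‖ ≤ C * (1 + |x|) ^ N := by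
  induction P using Polynomial.induction_on' with
  | add p q hp hq =>
    obtain ⟨C, N, hC, h⟩ := hp
    obtain ⟨C', N', hC', h'⟩ := hq
    refine ⟨C + C', N + N', by positivity, fun x => ?_⟩
    have h1 : 1 ≤ 1 + |x| := by linarith [abs_nonneg x]
    rw [Polynomial.eval_add, add_mul]
    refine (norm_add_le _ _).trans (add_le_add ((h x).trans ?_) ((h' x).trans ?_))
    · gcongr; omega
    · gcongr; omega
  | monomial n c =>
    refine ⟨‖c‖, n, norm_nonneg _, fun x => ?_⟩
    rw [Polynomial.eval_monomial, norm_mul, norm_pow, Complex.norm_real, Real.norm_eq_abs]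
    gcongr
    linarith

theorem summable_samplingTerm_polynomial {φ : ℝ → ℂ} {a : ℝ} {ρ : ℕ} (hρ : 1 ≤ ρ)
    (hΘ : ∀ N : ℕ, ∃ C : ℝ, 0 ≤ C ∧ ∀ (i : Fin ρ) (x : ℝ),
      (1 + |x|) ^ N * ‖reconstruction φ a ρ i x‖ ≤ C) {W : ℝ} (hW : 1 ≤ W) (P : ℂ[X]) (t : ℝ) :
    Summable (samplingTerm φ a ρ W (fun x : ℝ => P.eval (x : ℂ)) t) := by
  choose C N hC0 hC using fun i : ℕ => exists_polynomial_growth (Polynomial.derivative^[i] P)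
  set N' := ∑ i ∈ Finset.range ρ, N i with hN'
  set C' := ∑ i ∈ Finset.range ρ, C i with hC'
  have hC'0 : 0 ≤ C' := Finset.sum_nonneg fun i _ => hC0 i
  obtain ⟨D, -, hD⟩ := hΘ (N' + 2)
  refine summable_samplingTerm hρ hW hD (B := C' * (1 + |a| + |W * t|) ^ N') fun i hi l => ?_
  rw [iteratedDeriv_polynomial, mul_assoc, ← mul_pow]
  have hi' := Finset.mem_range.2 hi
  set s := (a + (ρ : ℝ) * (l : ℝ)) / W with hs
  have h1 : 1 + |s| ≤ (1 + |a| + |W * t|) * (1 + |W * t - ρ * (l : ℝ)|) := by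
    have h2 : |s| ≤ |a + (ρ : ℝ) * (l : ℝ)| := by
      rw [hs, abs_div]
      exact div_le_self (abs_nonneg _) (hW.trans (le_abs_self _))
    have h3 : |a + (ρ : ℝ) * (l : ℝ)| ≤ |a| + |W * t| + |W * t - ρ * (l : ℝ)| := by
      have e : a + (ρ : ℝ) * (l : ℝ) = a + W * t - (W * t - ρ * (l : ℝ)) := by ring
      rw [e]
      exact (abs_sub _ _).trans (by linarith [abs_add_le a (W * t)])
    nlinarith [abs_nonneg a, abs_nonneg (W * t), abs_nonneg (W * t - ρ * (l : ℝ)),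
      mul_nonneg (abs_nonneg a) (abs_nonneg (W * t - ρ * (l : ℝ))),
      mul_nonneg (abs_nonneg (W * t)) (abs_nonneg (W * t - ρ * (l : ℝ)))]
  have h1' : 1 ≤ 1 + |s| := by linarith [abs_nonneg s]
  calc _ ≤ C i * (1 + |s|) ^ N i := hC i s
    _ ≤ C' * (1 + |s|) ^ N' := by
      have a1 : C i ≤ C' := Finset.single_le_sum (f := C) (fun j _ => hC0 j) hi'
      have a2 : N i ≤ N' := Finset.single_le_sum (f := N) (fun j _ => Nat.zero_le _) hi'
      gcongr
    _ ≤ _ := by gcongr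

/-! ### The pointwise error estimate -/

/-- The quadratically weighted sum of a sequence around the index `n`. -/
def weightedSum (E : ℤ → ℝ) (n : ℤ) : ℝ≥0∞ :=
  ∑' m : ℤ, ENNReal.ofReal ((1 + |((n - m : ℤ) : ℝ)|) ^ 2)⁻¹ * ENNReal.ofReal (E m)

/-- An `m` between `n` and `k` is no farther from `n` than `k` is. The sum over a range depending on
`k` is thus replaced by one depending on `n` alone, for two powers of the distance. -/
theorem ofReal_sum_uIcc_le (E : ℤ → ℝ) (hE : ∀ m, 0 ≤ E m) (n k : ℤ) :
    ENNReal.ofReal (∑ m ∈ Finset.uIcc n k, E m) ≤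
      ENNReal.ofReal ((1 + |(n : ℝ) - k|) ^ 2) * weightedSum E n := by
  rw [ENNReal.ofReal_sum_of_nonneg fun m _ => hE m]
  refine le_trans ?_ (mul_le_mul_right (ENNReal.sum_le_tsum (Finset.uIcc n k)) _)
  rw [Finset.mul_sum]
  refine Finset.sum_le_sum fun m hm => ?_
  rw [← mul_assoc, ← ENNReal.ofReal_mul (by positivity)]
  refine le_mul_of_one_le_left zero_le ?_
  rw [ENNReal.one_le_ofReal, ← div_eq_mul_inv, one_le_div (by positivity)]
  have hm' : (m : ℝ) ∈ Set.uIcc (n : ℝ) k := by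
    rw [Finset.mem_uIcc] at hm
    rw [Set.uIcc, Set.mem_Icc]
    exact ⟨by exact_mod_cast hm.1, by exact_mod_cast hm.2⟩
  have h1 := Set.abs_sub_left_of_mem_uIcc hm'
  rw [abs_sub_comm, abs_sub_comm (k : ℝ)] at h1
  push_cast
  gcongr

/-- The reach `L` is fixed before `κ`, so that the mesh 1/(κW) can later be chosen small in terms of
`L`. -/
theorem exists_pointwise_error_bound {φ : ℝ → ℂ} {a : ℝ} {ρ r : ℕ} (hρ : 1 ≤ ρ) (hr : 1 ≤ r)
    (hΘ : ∀ N : ℕ, ∃ C : ℝ, 0 ≤ C ∧ ∀ (i : Fin ρ) (x : ℝ),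
      (1 + |x|) ^ N * ‖reconstruction φ a ρ i x‖ ≤ C)
    (hrep : ReproducesPolynomials φ a ρ r) :
    ∃ L : ℝ, 1 ≤ L ∧ ∀ κ : ℝ, 1 ≤ κ → ∃ C : ℝ≥0, ∀ (W d : ℝ) (_ : 1 ≤ W) (_ : d = (κ * W)⁻¹)
      (f : ℝ → ℂ) (_ : LocInt f)
      (_ : ∀ i : ℕ, i + 1 < ρ → Differentiable ℝ (iteratedDeriv i f))
      (_ : ∀ t, Summable (samplingTerm φ a ρ W f t))
      (e : ℕ → ℤ → ℝ) (_ : ∀ i k, 0 ≤ e i k)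
      (_ : ∀ i < ρ, ∀ (k : ℤ) (y h : ℝ), k * d ≤ y → 0 ≤ h → y + r * h ≤ (k + L) * d →
        ‖forwardDiff r h (iteratedDeriv i f) y‖ ≤ e i k)
      (n : ℤ) (t : ℝ), n * d ≤ t → t ≤ (n + 1) * d →
        ‖samplingOp φ a ρ W f t - f t‖ₑ ≤
          C * weightedSum (fun m => ∑ j ∈ Finset.range ρ, d ^ j * e j m) n := by
  obtain ⟨C₁, L, hC₁, hL, happ⟩ := exists_simultaneous_approximation (ρ := ρ) (r := r) hρ hr
  refine ⟨L, hL, fun κ hκ => ?_⟩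
  obtain ⟨S, hS0, hS⟩ := exists_tsum_inv_one_add_abs_le ρ hρ
  -- Of the r+4 powers, r absorb the growth of the approximation error, two the passage to
  -- `weightedSum`, and two sum over `l`.
  obtain ⟨C₂, hC₂, hΘ'⟩ := hΘ (r + 4)
  set κ' := κ * (2 + |a|) with hκ'
  have hκ'0 : 0 ≤ κ' := by positivity
  set c₁ := ρ * (κ ^ ρ * C₁ * C₂) with hc₁
  have hc₁0 : 0 ≤ c₁ := by positivity
  refine ⟨Real.toNNReal (c₁ * κ' ^ (r + 2) * S) + Real.toNNReal C₁, ?_⟩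
  intro W d hW hdW f hf hdiff hsum e he hω n t ht ht'
  have hd : 0 < d := by rw [hdW]; positivity
  obtain ⟨P, hPdeg, hP⟩ := happ d hd f hf hdiff e he hω
  set E : ℤ → ℝ := fun m => ∑ j ∈ Finset.range ρ, d ^ j * e j m with hE
  have hE0 : ∀ m, 0 ≤ E m := fun m => Finset.sum_nonneg fun j _ =>
    mul_nonneg (pow_nonneg hd.le _) (he j m)
  set B := weightedSum E n with hB
  set p : ℝ → ℂ := fun x => (P t).eval (x : ℂ) with hp
  have hdecomp : samplingOp φ a ρ W f t - f t =
      (∑' l, (samplingTerm φ a ρ W f t l - samplingTerm φ a ρ W p t l)) - (f t - p t) := by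
    rw [(hsum t).tsum_sub (summable_samplingTerm_polynomial hρ hΘ hW (P t) t)]
    have := hrep W hW (P t) (hPdeg t) t
    rw [samplingOp] at this
    rw [this, samplingOp]
    simp only [hp]
    ring
  have hterm : ∀ l : ℤ, ‖samplingTerm φ a ρ W f t l - samplingTerm φ a ρ W p t l‖ₑ ≤
      ENNReal.ofReal (c₁ * κ' ^ (r + 2) * ((1 + |W * t - ρ * (l : ℝ)|) ^ 2)⁻¹) * B := by
    intro l
    set s := (a + (ρ : ℝ) * (l : ℝ)) / W with hs
    set k := ⌊s / d⌋ with hk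
    set X := 1 + |W * t - ρ * (l : ℝ)| with hX
    set D := 1 + |(n : ℝ) - k| with hD
    set A := ∑ m ∈ Finset.uIcc n k, E m with hA
    have hA0 : 0 ≤ A := Finset.sum_nonneg fun m _ => hE0 m
    have hX0 : 0 < X := by positivity
    have hD0 : 0 < D := by positivity
    have hs1 : k * d ≤ s := by rw [← le_div_iff₀ hd]; exact Int.floor_le _
    have hs2 : s ≤ (k + 1) * d := by
      rw [← div_le_iff₀ hd]; exact (Int.lt_floor_add_one _).le
    have hDX : D ≤ κ' * X := by
      have h1 : |(n : ℝ) - k| ≤ |t - s| / d + 1 := by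
        have a1 : (n : ℝ) ≤ t / d := by rwa [le_div_iff₀ hd]
        have a2 : t / d ≤ n + 1 := by rwa [div_le_iff₀ hd]
        have a3 : (k : ℝ) ≤ s / d := by rwa [le_div_iff₀ hd]
        have a4 : s / d ≤ k + 1 := by rwa [div_le_iff₀ hd]
        have a5 : |t - s| / d = |t / d - s / d| := by
          rw [← sub_div, abs_div, abs_of_pos hd]
        rw [a5, abs_le]
        constructor
        · linarith [neg_abs_le (t / d - s / d)]
        · linarith [le_abs_self (t / d - s / d)]
      have h2 : |t - s| / d = κ * |W * t - ρ * (l : ℝ) - a| := by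
        have hW0 : W ≠ 0 := by positivity
        have : W * t - ρ * (l : ℝ) - a = W * (t - s) := by
          rw [hs]; field_simp; ring
        rw [this, abs_mul, abs_of_nonneg (by linarith : 0 ≤ W), hdW, div_inv_eq_mul]
        ring
      have h3 := abs_sub (W * t - ρ * (l : ℝ)) a
      have h4 : D ≤ 2 + κ * (|W * t - ρ * (l : ℝ)| + |a|) := by
        rw [h2] at h1
        have := mul_le_mul_of_nonneg_left h3 (by linarith : 0 ≤ κ)
        rw [hD]; linarith
      have h5 : 2 + κ * (|W * t - ρ * (l : ℝ)| + |a|) ≤ κ * (2 + (|W * t - ρ * (l : ℝ)| + |a|)) := by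
        nlinarith
      refine h4.trans (h5.trans ?_)
      rw [hκ', mul_assoc, hX]
      refine mul_le_mul_of_nonneg_left ?_ (by linarith)
      nlinarith [abs_nonneg a, abs_nonneg (W * t - ρ * (l : ℝ)),
        mul_nonneg (abs_nonneg a) (abs_nonneg (W * t - ρ * (l : ℝ)))]
    have hreal : ‖samplingTerm φ a ρ W f t l - samplingTerm φ a ρ W p t l‖ ≤
        c₁ * D ^ r * (X ^ (r + 4))⁻¹ * A := by
      rw [samplingTerm, samplingTerm, ← Finset.sum_sub_distrib]
      have h1 : ∀ i ∈ (Finset.univ : Finset (Fin ρ)),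
          ‖(1 / (W : ℂ) ^ (i : ℕ)) * iteratedDeriv (i : ℕ) f s *
            reconstruction φ a ρ i (W * t - (ρ : ℝ) * (l : ℝ)) -
          (1 / (W : ℂ) ^ (i : ℕ)) * iteratedDeriv (i : ℕ) p s *
            reconstruction φ a ρ i (W * t - (ρ : ℝ) * (l : ℝ))‖ ≤
          κ ^ ρ * C₁ * C₂ * D ^ r * (X ^ (r + 4))⁻¹ * A := by
        intro i _
        have h2 := hP n k t s ht ht' hs1 hs2 i i.2
        have h3 := hΘ' i (W * t - ρ * (l : ℝ))
        rw [← sub_mul, ← mul_sub, norm_mul, norm_mul]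
        have h4 : ‖1 / (W : ℂ) ^ (i : ℕ)‖ ≤ κ ^ ρ * d ^ (i : ℕ) := by
          rw [norm_div, norm_one, norm_pow, Complex.norm_real, Real.norm_of_nonneg (by linarith)]
          have e1 : 1 / W ^ (i : ℕ) = κ ^ (i : ℕ) * d ^ (i : ℕ) := by
            rw [hdW, ← mul_pow, one_div, ← inv_pow]
            congr 1
            field_simp
          rw [e1]
          gcongr
          exact i.2.le
        have h5 : ‖reconstruction φ a ρ i (W * t - (ρ : ℝ) * (l : ℝ))‖ ≤
            C₂ * (X ^ (r + 4))⁻¹ := by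
          rw [← div_eq_mul_inv, le_div_iff₀ (by positivity), mul_comm]
          exact h3
        calc _ ≤ κ ^ ρ * d ^ (i : ℕ) * ‖iteratedDeriv (i : ℕ) f s - iteratedDeriv (i : ℕ) p s‖ *
              (C₂ * (X ^ (r + 4))⁻¹) := by gcongr
          _ = κ ^ ρ * (C₂ * (X ^ (r + 4))⁻¹) *
              (d ^ (i : ℕ) * ‖iteratedDeriv (i : ℕ) f s - iteratedDeriv (i : ℕ) p s‖) := by ring
          _ ≤ κ ^ ρ * (C₂ * (X ^ (r + 4))⁻¹) * (C₁ * D ^ r * A) := by gcongr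
          _ = _ := by ring
      refine (norm_sum_le_of_le _ h1).trans (le_of_eq ?_)
      rw [Finset.sum_const, Finset.card_univ, Fintype.card_fin, nsmul_eq_mul, hc₁]
      ring
    rw [← ofReal_norm]
    refine (ENNReal.ofReal_le_ofReal hreal).trans ?_
    rw [ENNReal.ofReal_mul (by positivity)]
    refine (mul_le_mul_right (ofReal_sum_uIcc_le E hE0 n k) _).trans ?_
    rw [← mul_assoc, ← ENNReal.ofReal_mul (by positivity)]
    refine mul_le_mul_left (ENNReal.ofReal_le_ofReal ?_) _
    calc c₁ * D ^ r * (X ^ (r + 4))⁻¹ * D ^ 2 = c₁ * D ^ (r + 2) * (X ^ (r + 4))⁻¹ := by ring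
      _ ≤ c₁ * (κ' * X) ^ (r + 2) * (X ^ (r + 4))⁻¹ := by gcongr
      _ = c₁ * κ' ^ (r + 2) * (X ^ 2)⁻¹ := by
        rw [mul_pow, show r + 4 = (r + 2) + 2 by ring, pow_add X (r + 2) 2]
        field_simp
  have hself : ‖f t - p t‖ₑ ≤ ENNReal.ofReal C₁ * B := by
    have h1 := hP n n t t ht ht' ht ht' 0 (by omega)
    simp only [pow_zero, one_mul, iteratedDeriv_zero, sub_self, abs_zero, add_zero, one_pow,
      mul_one] at h1
    rw [← ofReal_norm]
    refine (ENNReal.ofReal_le_ofReal h1).trans ?_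
    rw [ENNReal.ofReal_mul hC₁]
    refine mul_le_mul_right ?_ _
    simpa using ofReal_sum_uIcc_le E hE0 n n
  rw [hdecomp]
  refine (enorm_sub_le).trans ?_
  rw [ENNReal.coe_add, add_mul]
  refine add_le_add ?_ hself
  refine enorm_tsum_le_tsum_enorm.trans ?_
  refine (ENNReal.tsum_le_tsum hterm).trans ?_
  rw [ENNReal.tsum_mul_right]
  refine mul_le_mul_left ?_ _
  rw [← ENNReal.ofReal_tsum_of_nonneg (fun l => by positivity) ((hS (W * t)).1.mul_left _),
    tsum_mul_left]
  exact ENNReal.ofReal_le_ofReal (mul_le_mul_of_nonneg_left (hS (W * t)).2 (by positivity))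

/-! ### Integrals over cells and a discrete Young inequality -/

/-- Only the cells need be measurable, not `g`; this allows `g` to be a power of the local modulus,
a supremum over uncountably many differences. -/
theorem lintegral_eq_tsum_cells {d : ℝ} (hd : 0 < d) (g : ℝ → ℝ≥0∞) :
    ∫⁻ x, g x = ∑' n : ℤ, ∫⁻ x in Set.Ico (n * d) ((n + 1) * d), g x := by
  have h1 := iUnion_Ico_zsmul hd
  have h2 := Set.pairwise_disjoint_Ico_zsmul d
  simp only [zsmul_eq_mul, Int.cast_add, Int.cast_one] at h1 h2
  rw [← lintegral_iUnion (fun n => measurableSet_Ico) h2, h1, Measure.restrict_univ]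

theorem volume_cell (d : ℝ) (n : ℤ) :
    volume (Set.Ico ((n : ℝ) * d) ((n + 1) * d)) = ENNReal.ofReal d := by
  rw [Real.volume_Ico]
  congr 1
  ring

theorem lintegral_le_tsum_cells {d : ℝ} (hd : 0 < d) {g : ℝ → ℝ≥0∞} {c : ℤ → ℝ≥0∞}
    (h : ∀ (n : ℤ) (x : ℝ), x ∈ Set.Ico ((n : ℝ) * d) ((n + 1) * d) → g x ≤ c n) :
    ∫⁻ x, g x ≤ ENNReal.ofReal d * ∑' n, c n := by
  rw [lintegral_eq_tsum_cells hd, ← ENNReal.tsum_mul_left]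
  refine ENNReal.tsum_le_tsum fun n => ?_
  refine (setLIntegral_mono' measurableSet_Ico (h n)).trans (le_of_eq ?_)
  rw [setLIntegral_const, volume_cell, mul_comm]

theorem tsum_cells_le_lintegral {d : ℝ} (hd : 0 < d) {g : ℝ → ℝ≥0∞} {c : ℤ → ℝ≥0∞}
    (h : ∀ (n : ℤ) (x : ℝ), x ∈ Set.Ico ((n : ℝ) * d) ((n + 1) * d) → c n ≤ g x) :
    ENNReal.ofReal d * ∑' n, c n ≤ ∫⁻ x, g x := by
  rw [lintegral_eq_tsum_cells hd, ← ENNReal.tsum_mul_left]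
  refine ENNReal.tsum_le_tsum fun n => ?_
  refine (le_of_eq ?_).trans (setLIntegral_mono' measurableSet_Ico (h n))
  rw [setLIntegral_const, volume_cell, mul_comm]

theorem rpow_tsum_mul_le {ι : Type*} {p : ℝ} (hp : 1 ≤ p) (w F : ι → ℝ≥0∞) :
    (∑' i, w i * F i) ^ p ≤ (∑' i, w i) ^ (p - 1) * ∑' i, w i * F i ^ p := by
  have hp0 : 0 < p := by linarith
  have h1 : ∑' i, w i * F i ≤ (∑' i, w i) ^ (1 - p⁻¹) * (∑' i, w i * F i ^ p) ^ p⁻¹ := by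
    rw [ENNReal.tsum_eq_iSup_sum]
    refine iSup_le fun s => (ENNReal.inner_le_weight_mul_Lp_of_nonneg s hp w F).trans ?_
    have : 0 ≤ 1 - p⁻¹ := sub_nonneg.2 (inv_le_one_of_one_le₀ hp)
    gcongr
    · exact ENNReal.sum_le_tsum s
    · exact ENNReal.sum_le_tsum s
  refine (ENNReal.rpow_le_rpow h1 hp0.le).trans (le_of_eq ?_)
  rw [ENNReal.mul_rpow_of_nonneg _ _ hp0.le, ← ENNReal.rpow_mul, ← ENNReal.rpow_mul,
    inv_mul_cancel₀ hp0.ne', ENNReal.rpow_one, sub_mul, one_mul, inv_mul_cancel₀ hp0.ne']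

/-- Young's inequality ℓ¹ ∗ ℓ^p ⊂ ℓ^p: weighted Hölder for each `n`, then an exchange of the two
sums. -/
theorem tsum_rpow_convolution_le {p : ℝ} (hp : 1 ≤ p) (w F : ℤ → ℝ≥0∞) :
    ∑' n : ℤ, (∑' m : ℤ, w (n - m) * F m) ^ p ≤
      (∑' v, w v) ^ (p - 1) * (∑' v, w v) * ∑' m, F m ^ p := by
  have h1 : ∀ n : ℤ, (∑' m : ℤ, w (n - m) * F m) ^ p ≤
      (∑' v, w v) ^ (p - 1) * ∑' m, w (n - m) * F m ^ p := by
    intro n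
    have h := rpow_tsum_mul_le hp (fun m => w (n - m)) F
    have e : ∑' m, w (n - m) = ∑' v, w v := (Equiv.subLeft n).tsum_eq w
    rwa [e] at h
  refine (ENNReal.tsum_le_tsum h1).trans (le_of_eq ?_)
  rw [ENNReal.tsum_mul_left, ENNReal.tsum_comm, mul_assoc]
  congr 1
  rw [← ENNReal.tsum_mul_left]
  refine tsum_congr fun m => ?_
  have e : ∑' n, w (n - m) = ∑' v, w v := (Equiv.subRight m).tsum_eq w
  rw [ENNReal.tsum_mul_right, e]

/-! ### Moduli of smoothness on cells -/

/-- The largest difference of order `r` with nodes in `[k d, (k + L) d]`. -/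
def cellModulus (r : ℕ) (g : ℝ → ℂ) (d L : ℝ) (k : ℤ) : ℝ≥0∞ :=
  ⨆ (y : ℝ) (h : ℝ) (_ : k * d ≤ y ∧ 0 ≤ h ∧ y + r * h ≤ (k + L) * d), ‖forwardDiff r h g y‖ₑ

/-- The window of the local modulus has half-width rδ/2 = rLd ≥ Ld, so it contains [kd, (k+L)d] for
each `x` in the cell. -/
theorem cellModulus_le_localModulus {r : ℕ} (hr : 1 ≤ r) (g : ℝ → ℂ) {d L : ℝ} (hd : 0 < d)
    (hL : 1 ≤ L) (k : ℤ) {x : ℝ} (hx : x ∈ Set.Ico ((k : ℝ) * d) ((k + 1) * d)) :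
    cellModulus r g d L k ≤ localModulus r g x (2 * L * d) := by
  refine iSup_le fun y => iSup_le fun h => iSup_le fun hy => ?_
  have hr1 : (1 : ℝ) ≤ r := by exact_mod_cast hr
  have h1 : L * d ≤ r * (2 * L * d) / 2 := by
    have : 0 ≤ L * d := by positivity
    nlinarith
  have h2 : d ≤ L * d := le_mul_of_one_le_left hd.le hL
  have h3 : 0 ≤ (r : ℝ) * h := mul_nonneg (by linarith) hy.2.1
  refine le_iSup_of_le y (le_iSup_of_le h (le_iSup_of_le ?_ le_rfl))
  obtain ⟨hy1, -, hy3⟩ := hy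
  obtain ⟨hx1, hx2⟩ := hx
  refine ⟨⟨?_, ?_⟩, ?_, ?_⟩ <;> linarith

theorem tsum_cellModulus_le {r : ℕ} (hr : 1 ≤ r) (g : ℝ → ℂ) {d L : ℝ} (hd : 0 < d)
    (hL : 1 ≤ L) {p : ℝ} (hp : 1 ≤ p) :
    ENNReal.ofReal d * ∑' k, cellModulus r g d L k ^ p ≤ tauModulus r p g (2 * L * d) ^ p := by
  have hp0 : 0 < p := by linarith
  rw [tauModulus, ← ENNReal.rpow_mul, one_div_mul_cancel hp0.ne', ENNReal.rpow_one]
  exact tsum_cells_le_lintegral hd fun n x hx =>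
    ENNReal.rpow_le_rpow (cellModulus_le_localModulus hr g hd hL n hx) hp0.le

theorem cellModulus_ne_top {r : ℕ} (hr : 1 ≤ r) (g : ℝ → ℂ) {d L : ℝ} (hd : 0 < d)
    (hL : 1 ≤ L) {p : ℝ} (hp : 1 ≤ p) (hτ : tauModulus r p g (2 * L * d) ≠ ⊤) (k : ℤ) :
    cellModulus r g d L k ≠ ⊤ := by
  have hp0 : 0 < p := by linarith
  intro h
  have h1 : ENNReal.ofReal d * cellModulus r g d L k ^ p ≤ tauModulus r p g (2 * L * d) ^ p :=
    (mul_le_mul_right (ENNReal.le_tsum k) _).trans (tsum_cellModulus_le hr g hd hL hp)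
  rw [h, ENNReal.top_rpow_of_pos hp0, ENNReal.mul_top (by simpa using hd), top_le_iff] at h1
  exact (ENNReal.rpow_ne_top_of_nonneg hp0.le hτ) h1

theorem norm_forwardDiff_le_cellModulus {r : ℕ} {g : ℝ → ℂ} {d L : ℝ} {k : ℤ}
    (hfin : cellModulus r g d L k ≠ ⊤) {y h : ℝ} (h1 : k * d ≤ y) (h2 : 0 ≤ h)
    (h3 : y + r * h ≤ (k + L) * d) :
    ‖forwardDiff r h g y‖ ≤ (cellModulus r g d L k).toReal := by
  rw [← toReal_enorm]
  refine ENNReal.toReal_mono hfin ?_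
  exact le_iSup_of_le y (le_iSup_of_le h (le_iSup_of_le ⟨h1, h2, h3⟩ le_rfl))

/-! ### Consequences of membership in `Λ_ρ^p` -/

theorem MemLambda.locInt {ρ : ℕ} {p : ℝ} {f : ℝ → ℂ} (hf : MemLambda ρ p f) : LocInt f := by
  obtain ⟨C, hC⟩ := hf.bounded
  intro a b
  rw [intervalIntegrable_iff]
  exact Measure.integrableOn_of_bounded (M := C) (by simp [Set.uIoc])
    hf.measurable.aestronglyMeasurable
    (Eventually.of_forall hC)

/-- The sampling points form an admissible sequence of constant gap ρ/W, and each term of the finite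
discrete norm is bounded by the whole sum. -/
theorem MemLambda.exists_sample_bound {ρ : ℕ} (hρ : 1 ≤ ρ) {p : ℝ} (hp : 1 ≤ p) {f : ℝ → ℂ}
    (hf : MemLambda ρ p f) (a : ℝ) {W : ℝ} (hW : 1 ≤ W) : ∃ B : ℝ, ∀ i < ρ, ∀ l : ℤ,
      ‖iteratedDeriv i f ((a + (ρ : ℝ) * (l : ℝ)) / W)‖ ≤ B := by
  have hp0 : 0 < p := by linarith
  have hW0 : 0 < W := by linarith
  have hρ0 : (0 : ℝ) < ρ := by exact_mod_cast hρ
  have hgap : ∀ j : ℤ, (a + (ρ : ℝ) * (j : ℝ)) / W - (a + (ρ : ℝ) * ((j - 1 : ℤ) : ℝ)) / W =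
      ρ / W := fun j => by push_cast; ring
  have h := hf.norm_lt_top (fun l => (a + (ρ : ℝ) * (l : ℝ)) / W)
    ⟨ρ / W, ρ / W, by positivity, fun j => by rw [hgap]; exact ⟨le_rfl, le_rfl⟩⟩
  simp only [discreteNorm, hgap] at h
  set T := ∑' j : ℤ, ∑ i ∈ Finset.range ρ,
    ‖iteratedDeriv i f ((a + (ρ : ℝ) * (j : ℝ)) / W)‖ₑ ^ p * ENNReal.ofReal (ρ / W) with hT
  have hTtop : T ≠ ⊤ := by
    intro h0
    rw [h0, ENNReal.top_rpow_of_pos (by positivity)] at h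
    exact lt_irrefl _ h
  have hc : ENNReal.ofReal (ρ / W) ≠ 0 := by
    rw [Ne, ENNReal.ofReal_eq_zero, not_le]; positivity
  refine ⟨((T / ENNReal.ofReal (ρ / W)) ^ p⁻¹).toReal, fun i hi l => ?_⟩
  rw [← toReal_enorm]
  refine ENNReal.toReal_mono
    (ENNReal.rpow_ne_top_of_nonneg (by positivity) (ENNReal.div_ne_top hTtop hc)) ?_
  rw [ENNReal.le_rpow_inv_iff hp0, ENNReal.le_div_iff_mul_le (Or.inl hc)
    (Or.inl ENNReal.ofReal_ne_top)]
  refine le_trans ?_ (ENNReal.le_tsum l)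
  exact Finset.single_le_sum (f := fun i =>
    ‖iteratedDeriv i f ((a + (ρ : ℝ) * (l : ℝ)) / W)‖ₑ ^ p * ENNReal.ofReal (ρ / W))
    (fun _ _ => zero_le) (Finset.mem_range.2 hi)

theorem measurable_samplingOp {φ : ℝ → ℂ} {a : ℝ} {ρ : ℕ}
    (hΘ : ∀ i : Fin ρ, Measurable (reconstruction φ a ρ i)) {W : ℝ} {f : ℝ → ℂ}
    (hs : ∀ t, Summable (samplingTerm φ a ρ W f t)) : Measurable (samplingOp φ a ρ W f) := by
  refine measurable_tsum_int (f := fun l t => samplingTerm φ a ρ W f t l) (fun l => ?_) hs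
  refine Finset.measurable_sum _ fun i _ => Measurable.const_mul ?_ _
  exact (hΘ i).comp ((measurable_id.const_mul W).sub_const _)

/-! ### The error estimate in `L^p` -/

theorem tsum_weight_ne_top :
    ∑' v : ℤ, ENNReal.ofReal ((1 + |(v : ℝ)|) ^ 2)⁻¹ ≠ ⊤ := by
  rw [← ENNReal.ofReal_tsum_of_nonneg (fun v => by positivity) summable_inv_one_add_abs_sq]
  exact ENNReal.ofReal_ne_top

theorem exists_eLpNorm_error_bound {φ : ℝ → ℂ} {a : ℝ} {ρ r : ℕ} (hρ : 1 ≤ ρ) (hr : 1 ≤ r)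
    (hΘ : ∀ N : ℕ, ∃ C : ℝ, 0 ≤ C ∧ ∀ (i : Fin ρ) (x : ℝ),
      (1 + |x|) ^ N * ‖reconstruction φ a ρ i x‖ ≤ C)
    (hrep : ReproducesPolynomials φ a ρ r) {p : ℝ} (hp : 1 ≤ p) :
    ∃ L : ℝ, 1 ≤ L ∧ ∀ κ : ℝ, 1 ≤ κ → ∃ C : ℝ≥0∞, C ≠ ⊤ ∧ ∀ (W d : ℝ) (_ : 1 ≤ W)
      (_ : d = (κ * W)⁻¹) (f : ℝ → ℂ) (_ : LocInt f)
      (_ : ∀ i : ℕ, i + 1 < ρ → Differentiable ℝ (iteratedDeriv i f))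
      (_ : ∀ t, Summable (samplingTerm φ a ρ W f t))
      (_ : ∀ i < ρ, tauModulus r p (iteratedDeriv i f) (2 * L * d) ≠ ⊤),
        ∫⁻ t, ‖samplingOp φ a ρ W f t - f t‖ₑ ^ p ≤
          C * ∑ i ∈ Finset.range ρ, tauModulus r p (iteratedDeriv i f) (2 * L * d) ^ p := by
  have hp0 : 0 < p := by linarith
  obtain ⟨L, hL, hpt⟩ := exists_pointwise_error_bound hρ hr hΘ hrep
  refine ⟨L, hL, fun κ hκ => ?_⟩
  obtain ⟨C, hC⟩ := hpt κ hκ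
  set S := ∑' v : ℤ, ENNReal.ofReal ((1 + |(v : ℝ)|) ^ 2)⁻¹ with hS
  have hStop : S ≠ ⊤ := tsum_weight_ne_top
  refine ⟨(C : ℝ≥0∞) ^ p * (S ^ (p - 1) * S * (ρ : ℝ≥0∞) ^ (p - 1)), ?_, ?_⟩
  · have h1 := ENNReal.rpow_ne_top_of_nonneg hp0.le (ENNReal.coe_ne_top (r := C))
    have h2 := ENNReal.rpow_ne_top_of_nonneg (sub_nonneg.2 hp) hStop
    have h3 := ENNReal.rpow_ne_top_of_nonneg (sub_nonneg.2 hp) (ENNReal.natCast_ne_top ρ)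
    exact ENNReal.mul_ne_top h1 (ENNReal.mul_ne_top (ENNReal.mul_ne_top h2 hStop) h3)
  intro W d hW hdW f hf hdiff hsum hτ
  have hκW : 1 ≤ κ * W := one_le_mul_of_one_le_of_one_le hκ hW
  have hd : 0 < d := by rw [hdW]; positivity
  have hd1 : d ≤ 1 := by rw [hdW]; exact inv_le_one_of_one_le₀ hκW
  set c : ℕ → ℤ → ℝ≥0∞ := fun i k => cellModulus r (iteratedDeriv i f) d L k with hc
  have hcfin : ∀ i < ρ, ∀ k, c i k ≠ ⊤ := fun i hi k =>
    cellModulus_ne_top hr _ hd hL hp (hτ i hi) k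
  set E : ℤ → ℝ := fun m => ∑ j ∈ Finset.range ρ, d ^ j * (c j m).toReal with hE
  have herr : ∀ (n : ℤ) (t : ℝ), t ∈ Set.Ico ((n : ℝ) * d) ((n + 1) * d) →
      ‖samplingOp φ a ρ W f t - f t‖ₑ ^ p ≤ (C * weightedSum E n) ^ p := fun n t ht =>
    ENNReal.rpow_le_rpow (hC W d hW hdW f hf hdiff hsum (fun i k => (c i k).toReal)
      (fun i k => ENNReal.toReal_nonneg)
      (fun i hi k y h h1 h2 h3 => norm_forwardDiff_le_cellModulus (hcfin i hi k) h1 h2 h3)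
      n t ht.1 ht.2.le) hp0.le
  -- The factors d^j ≤ 1 are discarded: the hypothesis gives the same rate for every derivative, so
  -- no gain from them is needed.
  have hEc : ∀ m, ENNReal.ofReal (E m) ^ p ≤
      (ρ : ℝ≥0∞) ^ (p - 1) * ∑ j ∈ Finset.range ρ, c j m ^ p := by
    intro m
    have h1 : ENNReal.ofReal (E m) ≤ ∑ j ∈ Finset.range ρ, c j m := by
      rw [hE, ENNReal.ofReal_sum_of_nonneg fun j _ =>
        mul_nonneg (pow_nonneg hd.le _) ENNReal.toReal_nonneg]
      refine Finset.sum_le_sum fun j hj => ?_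
      refine (ENNReal.ofReal_le_ofReal
        (mul_le_of_le_one_left ENNReal.toReal_nonneg (pow_le_one₀ hd.le hd1))).trans ?_
      rw [ENNReal.ofReal_toReal (hcfin j (Finset.mem_range.1 hj) m)]
    refine (ENNReal.rpow_le_rpow h1 hp0.le).trans ?_
    have h2 := ENNReal.rpow_sum_le_const_mul_sum_rpow (Finset.range ρ) (fun j => c j m) hp
    rwa [Finset.card_range] at h2
  have hYoung : ∑' n, weightedSum E n ^ p ≤ S ^ (p - 1) * S * ∑' m, ENNReal.ofReal (E m) ^ p :=
    tsum_rpow_convolution_le hp (fun v : ℤ => ENNReal.ofReal ((1 + |(v : ℝ)|) ^ 2)⁻¹)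
      fun m => ENNReal.ofReal (E m)
  have hτsum : ENNReal.ofReal d * ∑' m, ENNReal.ofReal (E m) ^ p ≤ (ρ : ℝ≥0∞) ^ (p - 1) *
      ∑ i ∈ Finset.range ρ, tauModulus r p (iteratedDeriv i f) (2 * L * d) ^ p := by
    calc _ ≤ ENNReal.ofReal d *
          ∑' m, (ρ : ℝ≥0∞) ^ (p - 1) * ∑ j ∈ Finset.range ρ, c j m ^ p :=
          mul_le_mul_right (ENNReal.tsum_le_tsum hEc) _
      _ = (ρ : ℝ≥0∞) ^ (p - 1) * ∑ j ∈ Finset.range ρ, ENNReal.ofReal d * ∑' m, c j m ^ p := by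
        rw [ENNReal.tsum_mul_left, Summable.tsum_finsetSum fun _ _ => ENNReal.summable,
          ← Finset.mul_sum]
        ring
      _ ≤ _ := by
        gcongr with j hj
        exact tsum_cellModulus_le hr _ hd hL hp
  calc ∫⁻ t, ‖samplingOp φ a ρ W f t - f t‖ₑ ^ p
      ≤ ENNReal.ofReal d * ∑' n, (C * weightedSum E n) ^ p := lintegral_le_tsum_cells hd herr
    _ = (C : ℝ≥0∞) ^ p * (ENNReal.ofReal d * ∑' n, weightedSum E n ^ p) := by
      simp only [ENNReal.mul_rpow_of_nonneg _ _ hp0.le]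
      rw [ENNReal.tsum_mul_left]
      ring
    _ ≤ (C : ℝ≥0∞) ^ p * (ENNReal.ofReal d *
        (S ^ (p - 1) * S * ∑' m, ENNReal.ofReal (E m) ^ p)) := by gcongr
    _ = (C : ℝ≥0∞) ^ p * (S ^ (p - 1) * S *
        (ENNReal.ofReal d * ∑' m, ENNReal.ofReal (E m) ^ p)) := by ring
    _ ≤ (C : ℝ≥0∞) ^ p * (S ^ (p - 1) * S * ((ρ : ℝ≥0∞) ^ (p - 1) *
        ∑ i ∈ Finset.range ρ, tauModulus r p (iteratedDeriv i f) (2 * L * d) ^ p)) := by gcongr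
    _ = _ := by ring

theorem exists_uniform_tau_bound {ρ r : ℕ} {p α : ℝ} {f : ℝ → ℂ}
    (hτ : ∀ i : ℕ, i < ρ → ∃ C : ℝ≥0, ∀ᶠ δ : ℝ in 𝓝[>] 0,
      tauModulus r p (iteratedDeriv i f) δ ≤ (C : ℝ≥0∞) * ENNReal.ofReal (δ ^ α)) :
    ∃ (C : ℝ≥0) (ε : ℝ), 0 < ε ∧ ∀ i < ρ, ∀ δ : ℝ, 0 < δ → δ < ε →
      tauModulus r p (iteratedDeriv i f) δ ≤ (C : ℝ≥0∞) * ENNReal.ofReal (δ ^ α) := by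
  choose! C hC using hτ
  have h1 : ∀ᶠ δ : ℝ in 𝓝[>] 0, ∀ i ∈ Finset.range ρ,
      tauModulus r p (iteratedDeriv i f) δ ≤ (C i : ℝ≥0∞) * ENNReal.ofReal (δ ^ α) :=
    (Filter.eventually_all_finset _).2 fun i hi => hC i (Finset.mem_range.1 hi)
  obtain ⟨ε, hε, hsub⟩ := mem_nhdsGT_iff_exists_Ioo_subset.1 h1
  refine ⟨∑ i ∈ Finset.range ρ, C i, ε, hε, fun i hi δ h0 h2 => ?_⟩
  refine (hsub ⟨h0, h2⟩ i (Finset.mem_range.2 hi)).trans ?_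
  gcongr
  exact Finset.single_le_sum (f := C) (fun _ _ => zero_le) (Finset.mem_range.2 hi)

end DerivativeSampling

end

/-! ### The order of approximation in `L^p` -/

theorem corollary4p5 (ρ : ℕ) (hρ : 1 ≤ ρ) (a : ℝ) (ha : a ∈ Set.Ico (0 : ℝ) ρ)
    (φ : ℝ → ℂ) (hφ : ContDiff ℝ ((ρ - 1 : ℕ) : ℕ∞) φ) (hφc : HasCompactSupport φ)
    (hΨ : ∀ t ∈ Set.Icc (0 : ℝ) 1, (DerivativeSampling.symbol φ a ρ t).det ≠ 0)
    (p : ℝ) (hp : 1 ≤ p) (α : ℝ) (hα : 0 < α) (r : ℕ) (hr : 1 ≤ r)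
    (hrep : DerivativeSampling.ReproducesPolynomials φ a ρ r)
    (f : ℝ → ℂ) (hf : DerivativeSampling.MemLambda ρ p f)
    (hτ : ∀ i : ℕ, i < ρ → ∃ C : ℝ≥0, ∀ᶠ δ : ℝ in 𝓝[>] 0,
      DerivativeSampling.tauModulus r p (iteratedDeriv i f) δ
        ≤ (C : ℝ≥0∞) * ENNReal.ofReal (δ ^ α)) :
    (∀ W : ℝ, 1 ≤ W →
      (∀ t : ℝ, Summable (DerivativeSampling.samplingTerm φ a ρ W f t)) ∧
      MemLp (fun t => DerivativeSampling.samplingOp φ a ρ W f t - f t)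
        (ENNReal.ofReal p) volume) ∧
    ∃ C : ℝ≥0, ∀ᶠ W : ℝ in atTop,
      eLpNorm (fun t => DerivativeSampling.samplingOp φ a ρ W f t - f t)
          (ENNReal.ofReal p) volume
        ≤ (C : ℝ≥0∞) * ENNReal.ofReal (W ^ (-α)) := by
  open DerivativeSampling in
  have hp0 : 0 < p := by linarith
  have hφcont : Continuous φ := hφ.continuous
  have hΘ := exists_reconstruction_decay hφcont hφc a hρ hΨ
  have hΘm := measurable_reconstruction hφcont hφc a hρ hΨ
  obtain ⟨L, hL, hmain⟩ := exists_eLpNorm_error_bound hρ hr hΘ hrep hp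
  obtain ⟨C₀, ε, hε, hτ'⟩ := exists_uniform_tau_bound hτ
  -- The bound on τ_r holds only for steps below ε. This κ gives 2L/(κW) < ε for every W ≥ 1, so the
  -- error is in `L^p` for all W ≥ 1 and not merely for large W.
  set κ := 2 * L / ε + 1 with hκ
  have hκ1 : 1 ≤ κ := by
    have : 0 ≤ 2 * L / ε := by positivity
    linarith
  obtain ⟨C, hC, hbound⟩ := hmain κ hκ1
  have hsum : ∀ W : ℝ, 1 ≤ W → ∀ t, Summable (samplingTerm φ a ρ W f t) := by
    intro W hW t
    obtain ⟨B, hB⟩ := hf.exists_sample_bound hρ hp a hW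
    obtain ⟨D, -, hD⟩ := hΘ (0 + 2)
    exact summable_samplingTerm hρ hW hD (fun i hi l => by simpa using hB i hi l)
  set M : ℝ≥0∞ := (C * (ρ * (C₀ * ENNReal.ofReal ((2 * L / κ) ^ α)) ^ p)) ^ (1 / p) with hM
  have hMtop : M ≠ ⊤ :=
    ENNReal.rpow_ne_top_of_nonneg (by positivity) (ENNReal.mul_ne_top hC
      (ENNReal.mul_ne_top (ENNReal.natCast_ne_top ρ) (ENNReal.rpow_ne_top_of_nonneg hp0.le
        (ENNReal.mul_ne_top ENNReal.coe_ne_top ENNReal.ofReal_ne_top))))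
  have hnorm : ∀ W : ℝ, 1 ≤ W →
      eLpNorm (fun t => samplingOp φ a ρ W f t - f t) (ENNReal.ofReal p) volume ≤
        M * ENNReal.ofReal (W ^ (-α)) := by
    intro W hW
    have hW0 : 0 < W := by linarith
    have hκ0 : 0 < κ := by linarith
    have hδ : 2 * L * (κ * W)⁻¹ = (2 * L / κ) * W⁻¹ := by
      rw [mul_inv, div_eq_mul_inv]; ring
    have hδ0 : 0 < 2 * L * (κ * W)⁻¹ := by positivity
    have hδε : 2 * L * (κ * W)⁻¹ < ε := by
      have h1 : 2 * L / κ < ε := by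
        rw [div_lt_iff₀ hκ0, hκ, mul_add, mul_div_cancel₀ _ hε.ne']
        linarith
      rw [hδ]
      refine lt_of_le_of_lt (mul_le_of_le_one_right (by positivity) ?_) h1
      exact inv_le_one_of_one_le₀ hW
    have hpow : ENNReal.ofReal ((2 * L * (κ * W)⁻¹) ^ α) =
        ENNReal.ofReal ((2 * L / κ) ^ α) * ENNReal.ofReal (W ^ (-α)) := by
      rw [hδ, Real.mul_rpow (by positivity) (by positivity), Real.inv_rpow hW0.le,
        ← Real.rpow_neg hW0.le, ENNReal.ofReal_mul (by positivity)]
    have hτW : ∀ i < ρ, tauModulus r p (iteratedDeriv i f) (2 * L * (κ * W)⁻¹) ≤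
        C₀ * (ENNReal.ofReal ((2 * L / κ) ^ α) * ENNReal.ofReal (W ^ (-α))) := fun i hi => by
      rw [← hpow]
      exact hτ' i hi _ hδ0 hδε
    have hint := hbound W _ hW rfl f hf.locInt hf.differentiable (hsum W hW) fun i hi =>
      ne_top_of_le_ne_top (ENNReal.mul_ne_top ENNReal.coe_ne_top
        (ENNReal.mul_ne_top ENNReal.ofReal_ne_top ENNReal.ofReal_ne_top)) (hτW i hi)
    have hle : ∑ i ∈ Finset.range ρ, tauModulus r p (iteratedDeriv i f) (2 * L * (κ * W)⁻¹) ^ p ≤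
        ρ * (C₀ * (ENNReal.ofReal ((2 * L / κ) ^ α) * ENNReal.ofReal (W ^ (-α)))) ^ p := by
      refine (Finset.sum_le_card_nsmul _ _ _ fun i hi =>
        ENNReal.rpow_le_rpow (hτW i (Finset.mem_range.1 hi)) hp0.le).trans (le_of_eq ?_)
      rw [Finset.card_range, nsmul_eq_mul]
    rw [eLpNorm_eq_lintegral_rpow_enorm_toReal (by simpa using hp0) ENNReal.ofReal_ne_top,
      ENNReal.toReal_ofReal hp0.le]
    refine (ENNReal.rpow_le_rpow (hint.trans (mul_le_mul_right hle C)) (by positivity)).trans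
      (le_of_eq ?_)
    rw [← mul_assoc (C₀ : ℝ≥0∞), ENNReal.mul_rpow_of_nonneg _ (ENNReal.ofReal (W ^ (-α))) hp0.le,
      ← mul_assoc, ← mul_assoc,
      ENNReal.mul_rpow_of_nonneg _ (ENNReal.ofReal (W ^ (-α)) ^ p) (by positivity),
      ← ENNReal.rpow_mul, mul_one_div_cancel hp0.ne', ENNReal.rpow_one, hM, mul_assoc C]
  refine ⟨fun W hW => ⟨hsum W hW, ?_, ?_⟩, M.toNNReal, ?_⟩
  · exact (measurable_samplingOp hΘm (hsum W hW)).aestronglyMeasurable.sub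
      hf.measurable.aestronglyMeasurable
  · exact (hnorm W hW).trans_lt (ENNReal.mul_lt_top hMtop.lt_top ENNReal.ofReal_lt_top)
  · filter_upwards [eventually_ge_atTop 1] with W hW
    rw [ENNReal.coe_toNNReal hMtop]
    exact hnorm W hW
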